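/- Let $Q=(Q^0,Q^1,r,s)$ be a countable oriented graph ($Q^0$ and $Q^1$ countable, possibly finite) and let $1\le p<\infty$. Let $L_Q$ be its Leavitt path algebra, i.e. the quotient of the free (not necessarily unital) $\mathbb C$-algebra on the symbols $v\in Q^0$, $e,e^*$ ($e\in Q^1$) by the relations $vv'=\delta_{v,v'}v$, $s(e)e=er(e)=e$, $r(e)e^*=e^*s(e)=e^*$, $e^*e'=\delta_{e,e'}r(e)$, and $v=\sum_{s(e)=v}ee^*$ whenever $v$ is regular, i.e. $s^{-1}(v)$ is finite and nonempty. Definitions. Let $(X,\mu)$ be a $\sigma$-finite measure space. An isometric isomorphism $u:L^p(A)\to L^p(B)$, with $A,B\subset X$ measurable, is *spatial* if $u(\xi)=h\cdot\left(\frac{dS_*\mu|_A}{d\mu|_B}\right)^{1/p}S_*(\xi)$ for some isomorphism $S$ between the $\sigma$-algebras of measurable subsets of $A$ and of $B$ modulo null sets and some measurable $h$ with $|h|=1$ a.e. A *spatial partial isometry* of $L^p(X)$ is an operator $\iota_B u\pi_A$ with $u$ spatial, $\pi_A$ the restriction to $A$ and $\iota_B$ the extension by zero; its *reverse* is $\iota_A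 u^{-1}\pi_B$. A homomorphism $\rho:L_Q\to\mathcal L(L^p(X))$ is a *spatial representation* if each $\rho(v)$ is an idempotent spatial partial isometry and each $\rho(e)$ is a spatial partial isometry with reverse $\rho(e^*)$; it is *nondegenerate* if $\rho(L_Q)L^p(X)$ is dense in $L^p(X)$. The *spatial norm* of $a\in L_Q$ is $\|a\|=\sup_\rho\|\rho(a)\|$, over all spatial representations $\rho$ on $L^p$-spaces of $\sigma$-finite measure spaces. Let $\mathcal S(Q)=\{0\}\cup\{\alpha\beta^*:\alpha,\beta \text{ finite paths}\}\subset L_Q$ be the inverse semigroup of $Q$. An *action* $S$ of $\mathcal S(Q)$ on a set $X$ is a semigroup homomorphism from $\mathcal S(Q)$ to the partially defined injections of $X$, with $S_0=\emptyset$. Let $X_v$ be the domain of $S_v$ and $X_e$ the range of $S_e$. The action is *tight* if $X=\coprod_{v\in Q^0}X_v$, and $X_v=\coprod_{s(e)=v}X_e$ for every regular $v$. Its *groupoid of germs* $\mathcal G$ consists of the classes $[t,x]$ with $t\in\mathcal S(Q)$ and $x\in\operatorname{dom}S_t$, where $[t,x]=[t',x']$ iff $x=x'$ and $tf=t'f$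 for some idempotent $f\in\mathcal S(Q)$ with $x\in\operatorname{dom}S_f$; the product is $[t,S_{t'}(x)][t',x]=[tt',x]$. For $t\in\mathcal S(Q)$ put $\Theta_t=\{[t,x]:x\in\operatorname{dom}S_t\}$. Claim. (1) If $Q^0\ne\emptyset$, then $L_Q$ has an injective, nondegenerate spatial representation $\rho:L_Q\to\mathcal L(\ell^p(\mathbb N))$. Moreover $\rho$ can be chosen so that there are a tight action of $\mathcal S(Q)$ on a countable set, with groupoid of germs $\mathcal G$, and a bijection $\mathcal G\cong\mathbb N$ such that, under the induced identification $\ell^p(\mathbb N)=\ell^p(\mathcal G)$, every $t\in\mathcal S(Q)$ acts by convolution with the characteristic function of $\Theta_t$: $$\rho(t)(\xi)(l)=\sum_{gk=l}\chi_{\Theta_t}(g)\,\xi(k)\qquad(\xi\in\ell^p(\mathcal G),\ l\in\mathcal G).$$ (2) The spatial norm on $L_Q$ is a genuine norm: the supremum defining $\|a\|$ is finite for every $a\in L_Q$, $\|a+b\|\le\|a\|+\|b\|$ and $\|za\|=|z|\,\|a\|$ for all $a,b\in L_Q$ and $z\in\mathbb C$, and $\|a\|=0$ only if $a=0$. -/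

import Mathlib

open MeasureTheory
open scoped ENNReal

universe u v w

noncomputable section

namespace Leavitt

/-! ## Oriented graphs and Leavitt path algebras -/

/-- An oriented graph with vertex set `V` and edge set `E`. -/
structure OrientedGraph (V : Type u) (E : Type v) where
  /-- the source of an edge -/
  src : E → V
  /-- the range of an edge -/
  rng : E → V

variable {V : Type u} {E : Type v}

/-- A vertex is regular if it emits a finite nonzero number of edges. -/
def OrientedGraph.IsRegular (Q : OrientedGraph V E) (a : V) : Prop :=
  {e : E | Q.src e = a}.Finite ∧ {e : E | Q.src e = a}.Nonempty

/-- The generators of the Leavitt path algebra: vertices `v`, edges `e`, ghost edges `e*`. -/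
inductive Gen (V : Type u) (E : Type v) : Type (max u v)
  | vertex : V → Gen V E
  | edge : E → Gen V E
  | ghost : E → Gen V E

/-- A vertex in the free algebra. -/
abbrev fv (a : V) : FreeAlgebra ℂ (Gen V E) := FreeAlgebra.ι ℂ (Gen.vertex a)

/-- An edge in the free algebra. -/
abbrev fe (e : E) : FreeAlgebra ℂ (Gen V E) := FreeAlgebra.ι ℂ (Gen.edge e)

/-- A ghost edge in the free algebra. -/
abbrev fg (e : E) : FreeAlgebra ℂ (Gen V E) := FreeAlgebra.ι ℂ (Gen.ghost e)

/-- The defining relations of the Leavitt path algebra. -/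
inductive Rel (Q : OrientedGraph V E) :
    FreeAlgebra ℂ (Gen V E) → FreeAlgebra ℂ (Gen V E) → Prop
  | vertex_mul_self (a : V) : Rel Q (fv a * fv a) (fv a)
  | vertex_mul_of_ne (a b : V) (h : a ≠ b) : Rel Q (fv a * fv b) 0
  | src_mul_edge (e : E) : Rel Q (fv (Q.src e) * fe e) (fe e)
  | edge_mul_rng (e : E) : Rel Q (fe e * fv (Q.rng e)) (fe e)
  | rng_mul_ghost (e : E) : Rel Q (fv (Q.rng e) * fg e) (fg e)
  | ghost_mul_src (e : E) : Rel Q (fg e * fv (Q.src e)) (fg e)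
  | ck1_self (e : E) : Rel Q (fg e * fe e) (fv (Q.rng e))
  | ck1_of_ne (e f : E) (h : e ≠ f) : Rel Q (fg e * fe f) 0
  | ck2 (a : V) (h : Q.IsRegular a) : Rel Q (fv a) (∑ e ∈ h.1.toFinset, fe e * fg e)

/-- The unital algebra presented by the generators and relations of the Leavitt path algebra.
Since no relation involves the unit, it is the Leavitt path algebra with a unit adjoined. -/
abbrev UnitalLeavitt (Q : OrientedGraph V E) : Type (max u v) := RingQuot (Rel Q)

/-- The image of a generator. -/
def gen (Q : OrientedGraph V E) (x : Gen V E) : UnitalLeavitt Q :=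
  RingQuot.mkAlgHom ℂ (Rel Q) (FreeAlgebra.ι ℂ x)

/-- The Leavitt path algebra `L_Q`, an algebra that need not have a unit: the quotient of the free
(non-unital) algebra on vertices, edges and ghost edges by the relations `Rel Q`. It is the
non-unital subalgebra spanned by the nonempty words in the generators. -/
abbrev LPA (Q : OrientedGraph V E) : Type (max u v) :=
  ↥(NonUnitalAlgebra.adjoin ℂ (Set.range (gen Q)))

/-- A generator as an element of `L_Q`. -/
def LPA.of (Q : OrientedGraph V E) (x : Gen V E) : LPA Q :=
  ⟨gen Q x, NonUnitalAlgebra.subset_adjoin ℂ (Set.mem_range_self x)⟩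

/-- The vertex `a` as an element of `L_Q`. -/
def LPA.vertex (Q : OrientedGraph V E) (a : V) : LPA Q := LPA.of Q (Gen.vertex a)

/-- The edge `e` as an element of `L_Q`. -/
def LPA.edge (Q : OrientedGraph V E) (e : E) : LPA Q := LPA.of Q (Gen.edge e)

/-- The ghost edge `e*` as an element of `L_Q`. -/
def LPA.ghost (Q : OrientedGraph V E) (e : E) : LPA Q := LPA.of Q (Gen.ghost e)

/-! ## Spatial partial isometries of `L^p`-spaces -/

section Spatial

variable {X : Type w} [MeasurableSpace X]

/-- A bijective measurable set transformation, that is, a bijective homomorphism from the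
`σ`-algebra of measurable sets modulo `μ`-null sets to that of measurable sets modulo
`ν`-null sets. It is given on representatives. -/
structure SetTransformation (μ ν : Measure X) where
  /-- the map on representatives -/
  toFun : Set X → Set X
  measurableSet' : ∀ F, MeasurableSet F → MeasurableSet (toFun F)
  congr' : ∀ F G, MeasurableSet F → MeasurableSet G → F =ᵐ[μ] G → toFun F =ᵐ[ν] toFun G
  compl' : ∀ F, MeasurableSet F → toFun Fᶜ =ᵐ[ν] (toFun F)ᶜ
  iUnion' : ∀ F : ℕ → Set X, (∀ n, MeasurableSet (F n)) →
    toFun (⋃ n, F n) =ᵐ[ν] ⋃ n, toFun (F n)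
  injective' : ∀ F G, MeasurableSet F → MeasurableSet G → toFun F =ᵐ[ν] toFun G → F =ᵐ[μ] G
  surjective' : ∀ G, MeasurableSet G → ∃ F, MeasurableSet F ∧ toFun F =ᵐ[ν] G

/-- `κ` is the image measure `S_*(μ) = μ ∘ S⁻¹`. It is determined by these conditions, since
every measurable set agrees, up to a `ν`-null set, with `S F` for some `F`. -/
def SetTransformation.IsImageMeasure {μ ν : Measure X} (S : SetTransformation μ ν)
    (κ : Measure X) : Prop :=
  κ ≪ ν ∧ ∀ F, MeasurableSet F → κ (S.toFun F) = μ F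

/-- `η` is the image `S_*(ξ)` of the measurable function `ξ`: `{η ∈ U} = S {ξ ∈ U}` up to null
sets, for every Borel set `U`; in particular `S_*(χ_F) = χ_{S(F)}`. -/
def SetTransformation.IsImageFunction {μ ν : Measure X} (S : SetTransformation μ ν)
    (ξ η : X → ℂ) : Prop :=
  Measurable η ∧ ∀ U : Set ℂ, MeasurableSet U → η ⁻¹' U =ᵐ[ν] S.toFun (ξ ⁻¹' U)

variable {p : ℝ≥0∞} [Fact (1 ≤ p)]

/-- An isometric isomorphism `u` of `L^p`-spaces is spatial if there are a bijective measurable set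
transformation `S` and a measurable `h` with `|h| = 1` a.e. such that
`u ξ = h · (dS_*(μ)/dν)^{1/p} · S_* ξ` for all `ξ`. -/
def IsSpatialIso {μ ν : Measure X} (U : Lp ℂ p μ ≃ₗᵢ[ℂ] Lp ℂ p ν) : Prop :=
  ∃ (S : SetTransformation μ ν) (κ : Measure X) (h : X → ℂ),
    S.IsImageMeasure κ ∧ Measurable h ∧ (∀ᵐ x ∂ν, ‖h x‖ = 1) ∧
    ∀ ξ : Lp ℂ p μ, ∃ η : X → ℂ, S.IsImageFunction ξ η ∧
      U ξ =ᵐ[ν] fun x => h x * (((κ.rnDeriv ν x).toReal ^ (1 / p.toReal) : ℝ) : ℂ) * η x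

/-- `s = ι_B ∘ U ∘ π_A`: restrict to `A`, apply `U : L^p(A) → L^p(B)`, extend by zero. The space
`L^p(A)` is the `L^p`-space of the restriction of the measure to `A`. -/
def Factors {μ : Measure X} (s : Lp ℂ p μ →L[ℂ] Lp ℂ p μ) (A B : Set X)
    (U : Lp ℂ p (μ.restrict A) ≃ₗᵢ[ℂ] Lp ℂ p (μ.restrict B)) : Prop :=
  ∀ ξ : Lp ℂ p μ, s ξ =ᵐ[μ] B.indicator (U (LpToLpRestrictCLM X ℂ ℂ μ p A ξ))

/-- `s` is a spatial partial isometry with reverse `t`: `s = ι_B U π_A` and `t = ι_A U⁻¹ π_B`, with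
`A`, `B` measurable and `U : L^p(A) → L^p(B)` a spatial isometric isomorphism. -/
def IsSpatialWithReverse {μ : Measure X} (s t : Lp ℂ p μ →L[ℂ] Lp ℂ p μ) : Prop :=
  ∃ (A B : Set X) (U : Lp ℂ p (μ.restrict A) ≃ₗᵢ[ℂ] Lp ℂ p (μ.restrict B)),
    MeasurableSet A ∧ MeasurableSet B ∧ IsSpatialIso U ∧ Factors s A B U ∧ Factors t B A U.symm

/-- `s` is a spatial partial isometry. -/
def IsSpatialPartialIsometry {μ : Measure X} (s : Lp ℂ p μ →L[ℂ] Lp ℂ p μ) : Prop :=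
  ∃ t, IsSpatialWithReverse s t

/-! ## Spatial representations -/

/-- A representation of `L_Q` on `L^p(X, μ)` is spatial if vertices act by spatial idempotents and
every edge `e` acts by a spatial partial isometry whose reverse is the action of `e*`. -/
structure IsSpatial (Q : OrientedGraph V E) {μ : Measure X}
    (ρ : LPA Q →ₙₐ[ℂ] (Lp ℂ p μ →L[ℂ] Lp ℂ p μ)) : Prop where
  vertex : ∀ a : V, IsIdempotentElem (ρ (LPA.vertex Q a)) ∧
    IsSpatialPartialIsometry (ρ (LPA.vertex Q a))
  edge : ∀ e : E, IsSpatialWithReverse (ρ (LPA.edge Q e)) (ρ (LPA.ghost Q e))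

end Spatial

/-- A representation of `L_Q` on a Banach space `B` is nondegenerate if `ρ(L_Q)B` is dense. -/
def IsNondegenerate (Q : OrientedGraph V E) {B : Type w} [NormedAddCommGroup B] [NormedSpace ℂ B]
    (ρ : LPA Q →ₙₐ[ℂ] (B →L[ℂ] B)) : Prop :=
  Dense {η : B | ∃ (a : LPA Q) (ξ : B), ρ a ξ = η}

/-- The Banach space `ℓ^p(ℕ)`. -/
abbrev EllP (p : ℝ≥0∞) [Fact (1 ≤ p)] : Type := Lp ℂ p (Measure.count : Measure ℕ)

/-- The spatial `p`-seminorms on `L_Q`: the functions `a ↦ ‖ρ(a)‖`, for `ρ` a spatial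
representation of `L_Q` on `L^p` of a `σ`-finite measure space. -/
def spatialSeminorms (Q : OrientedGraph V E) (p : ℝ≥0∞) [Fact (1 ≤ p)] : Set (LPA Q → ℝ) :=
  {N | ∃ (X : Type w) (_ : MeasurableSpace X) (μ : Measure X) (_ : SigmaFinite μ)
    (ρ : LPA Q →ₙₐ[ℂ] (Lp ℂ p μ →L[ℂ] Lp ℂ p μ)), IsSpatial Q ρ ∧ ∀ a, N a = ‖ρ a‖}

/-- The spatial norm on `L_Q`: the supremum of the spatial `p`-seminorms. -/
def spatialNorm (Q : OrientedGraph V E) (p : ℝ≥0∞) [Fact (1 ≤ p)] (a : LPA Q) : ℝ :=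
  sSup {c : ℝ | ∃ N ∈ spatialSeminorms.{u, v, w} Q p, c = N a}

/-! ## Tight actions and the groupoid of germs -/

/-- The inverse semigroup `S(Q) = {0} ∪ {α β* : α, β finite paths}` of `Q`, the multiplicative
subsemigroup of `L_Q` generated by `0`, the vertices, the edges and the ghost edges. -/
def invSemigroup (Q : OrientedGraph V E) : Subsemigroup (LPA Q) :=
  Subsemigroup.closure (insert 0 (Set.range (LPA.of Q)))

/-- A generator as an element of `S(Q)`. -/
def invSemigroup.of (Q : OrientedGraph V E) (x : Gen V E) : invSemigroup Q :=
  ⟨LPA.of Q x, Subsemigroup.subset_closure (Set.mem_insert_of_mem _ (Set.mem_range_self x))⟩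

/-- The zero of `S(Q)`. -/
def invSemigroup.zero (Q : OrientedGraph V E) : invSemigroup Q :=
  ⟨0, Subsemigroup.subset_closure (Set.mem_insert _ _)⟩

/-- An action of `S(Q)` on a set `X` by partially defined injections: a semigroup homomorphism to
the inverse semigroup of partial injections under composition, mapping `0` to the empty map. -/
structure PartialAction (Q : OrientedGraph V E) (X : Type w) where
  /-- the partial injection given by an element of `S(Q)` -/
  toFun : invSemigroup Q → (X ≃. X)
  map_mul' : ∀ s t, toFun (s * t) = (toFun t).trans (toFun s)
  map_zero' : toFun (invSemigroup.zero Q) = ⊥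

namespace PartialAction

variable {Q : OrientedGraph V E} {X : Type w} (S : PartialAction Q X)

/-- The set `X_a` for a vertex `a`: the domain of the idempotent partial injection `S_a`. -/
def vertexSet (a : V) : Set X := {x | ∃ y, S.toFun (invSemigroup.of Q (Gen.vertex a)) x = some y}

/-- The set `X_e` for an edge `e`: the range of the partial injection `S_e`. -/
def edgeSet (e : E) : Set X := {x | ∃ y, S.toFun (invSemigroup.of Q (Gen.edge e)) y = some x}

/-- The action is tight if `X` is the disjoint union of the sets `X_a`, and `X_a` is the disjoint
union of the sets `X_e` with `e` of source `a`, for every regular vertex `a`. -/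
structure IsTight : Prop where
  disjoint_vertexSet : Pairwise fun a b => Disjoint (S.vertexSet a) (S.vertexSet b)
  iUnion_vertexSet : ⋃ a, S.vertexSet a = Set.univ
  disjoint_edgeSet : ∀ a, Q.IsRegular a →
    {e | Q.src e = a}.Pairwise fun e f => Disjoint (S.edgeSet e) (S.edgeSet f)
  iUnion_edgeSet : ∀ a, Q.IsRegular a → S.vertexSet a = ⋃ e ∈ {e | Q.src e = a}, S.edgeSet e

/-- Pairs `(s, x)` with `s ∈ S(Q)` and `x` in the domain of the partial injection of `s`. -/
structure PreGerm where
  /-- the semigroup element -/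
  elt : invSemigroup Q
  /-- the base point -/
  pt : X
  mem_dom : ∃ y, S.toFun elt pt = some y

/-- `(s, x)` and `(t, x)` have the same germ if `s f = t f` for some idempotent `f` of `S(Q)` whose
domain contains `x`. -/
def GermRel (g k : S.PreGerm) : Prop :=
  g.pt = k.pt ∧ ∃ f : invSemigroup Q, f * f = f ∧ (∃ y, S.toFun f g.pt = some y) ∧
    g.elt * f = k.elt * f

/-- The groupoid of germs of the action. -/
def Germ : Type (max u v w) := Quot S.GermRel

/-- The germ `[s, x]`. -/
def germ (g : S.PreGerm) : S.Germ := Quot.mk _ g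

/-- `g k = l` in the groupoid of germs: `[s, S_t(y)] [t, y] = [s t, y]`. -/
def IsProduct (g k l : S.Germ) : Prop :=
  ∃ a b c : S.PreGerm, S.germ a = g ∧ S.germ b = k ∧ S.germ c = l ∧
    S.toFun b.elt b.pt = some a.pt ∧ c.elt = a.elt * b.elt ∧ c.pt = b.pt

/-- The set `Θ_s = {[s, x] : x in the domain of s}` of germs. -/
def bisection (s : invSemigroup Q) : Set S.Germ := {g | ∃ a : S.PreGerm, a.elt = s ∧ S.germ a = g}

/-- The convolution `(f * ξ)(l) = ∑_{g k = l} f(g) ξ(k) = ∑_g f(g) ξ(g⁻¹ l)` of functions on the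
groupoid of germs. -/
def convolution (f ξ : S.Germ → ℂ) (l : S.Germ) : ℂ :=
  ∑ᶠ q ∈ {q : S.Germ × S.Germ | S.IsProduct q.1 q.2 l}, f q.1 * ξ q.2

end PartialAction

end Leavitt

end

noncomputable section

namespace Leavitt

variable {V : Type u} {E : Type v}

/-! ## Relations and normal forms in the Leavitt path algebra -/

namespace LPA

variable (Q : OrientedGraph V E)

/-! Everything comes from one combinatorial model. On a countable set `X ≅ V × ℕ × ℤ`, let each edge
act as an injection `X_{r(e)} → X_{s(e)}`, with disjoint ranges that cover `X_a` for regular `a` and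
miss a point for singular `a`. The `ℕ` factor leaves room for countably many disjoint copies. The
`ℤ` factor is a degree raised by one by every edge. These partial injections satisfy the Leavitt
relations, so `L_Q` acts on functions on `X` and `S(Q)` acts tightly on `X`.

Faithfulness (`IsFaithful.eq_zero`): by the relation at regular vertices, every element is a
combination of monomials `αβ*` with `|β| = n`, or with `|β| < n` and a singular end vertex. If `y`
lies over that vertex, outside all edge ranges in the singular case, then the delta function at
`βy`, evaluated at `αy`, isolates the coefficient of `αβ*` once those with shorter `β` vanish. The
degree prevents different `α` from interfering.

Germs (`IsFaithful.exists_idempotent`): the degree also forces two elements of `S(Q)` that agree at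
a point to have the same germ there. Hence the groupoid of germs embeds in `X × X` by range and
source, and convolution by the characteristic function of `Θ_t` becomes `(x, y) ↦ (S_t x, y)`. This
is again a faithful branching system, now on a set in bijection with `ℕ`.

On a countable set with counting measure, partial injections induce spatial partial isometries of
`ℓ^p`, which gives the required representation. Generators are contractions in every spatial
representation, so the spatial norm is finite; an injective spatial representation makes it
definite. -/

theorem ext_of_rel {a b : LPA Q} {x y : FreeAlgebra ℂ (Gen V E)} (h : Rel Q x y)
    (ha : a.1 = RingQuot.mkAlgHom ℂ (Rel Q) x) (hb : b.1 = RingQuot.mkAlgHom ℂ (Rel Q) y) :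
    a = b :=
  Subtype.ext (by rw [ha, hb]; exact RingQuot.mkAlgHom_rel ℂ h)

theorem vertex_mul_self (a : V) : vertex Q a * vertex Q a = vertex Q a :=
  ext_of_rel Q (.vertex_mul_self a) (by simp [vertex, of, gen]) rfl

theorem vertex_mul_of_ne {a b : V} (h : a ≠ b) : vertex Q a * vertex Q b = 0 :=
  ext_of_rel Q (.vertex_mul_of_ne a b h) (by simp [vertex, of, gen]) (by simp)

theorem src_mul_edge (e : E) : vertex Q (Q.src e) * edge Q e = edge Q e :=
  ext_of_rel Q (.src_mul_edge e) (by simp [vertex, edge, of, gen]) rfl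

theorem edge_mul_rng (e : E) : edge Q e * vertex Q (Q.rng e) = edge Q e :=
  ext_of_rel Q (.edge_mul_rng e) (by simp [vertex, edge, of, gen]) rfl

theorem rng_mul_ghost (e : E) : vertex Q (Q.rng e) * ghost Q e = ghost Q e :=
  ext_of_rel Q (.rng_mul_ghost e) (by simp [vertex, ghost, of, gen]) rfl

theorem ghost_mul_src (e : E) : ghost Q e * vertex Q (Q.src e) = ghost Q e :=
  ext_of_rel Q (.ghost_mul_src e) (by simp [vertex, ghost, of, gen]) rfl

theorem ghost_mul_edge (e : E) : ghost Q e * edge Q e = vertex Q (Q.rng e) :=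
  ext_of_rel Q (.ck1_self e) (by simp [edge, ghost, of, gen]) rfl

theorem ghost_mul_edge_of_ne {e f : E} (h : e ≠ f) : ghost Q e * edge Q f = 0 :=
  ext_of_rel Q (.ck1_of_ne e f h) (by simp [edge, ghost, of, gen]) (by simp)

theorem vertex_eq_sum (a : V) (h : Q.IsRegular a) :
    vertex Q a = ∑ e ∈ h.1.toFinset, edge Q e * ghost Q e :=
  ext_of_rel Q (.ck2 a h) rfl (by
    simp [edge, ghost, of, gen])

/-! ### Paths and the monomials `αβ*` -/

/-- The start vertex of a list of edges regarded as a path ending at `a`. -/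
def start (a : V) : List E → V
  | [] => a
  | e :: _ => Q.src e

/-- A list of edges is a path ending at `a`. -/
def IsPath (a : V) : List E → Prop
  | [] => True
  | e :: l => Q.rng e = start Q a l ∧ IsPath a l

/-- The product of a list of edges and the vertex `a`. -/
def path (a : V) : List E → LPA Q
  | [] => vertex Q a
  | e :: l => edge Q e * path a l

/-- The adjoint of `path`. -/
def copath (a : V) : List E → LPA Q
  | [] => vertex Q a
  | e :: l => copath a l * ghost Q e

/-- The element `α β*` of `L_Q`, for paths `α` and `β` ending at `a`. -/
def mono (a : V) (α β : List E) : LPA Q := path Q a α * copath Q a β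

theorem vertex_start_mul_path (a : V) (l : List E) :
    vertex Q (start Q a l) * path Q a l = path Q a l := by
  cases l with
  | nil => exact vertex_mul_self Q a
  | cons e l => simp only [start, path, ← mul_assoc, src_mul_edge]

theorem vertex_mul_path_of_ne {a b : V} {l : List E} (h : b ≠ start Q a l) :
    vertex Q b * path Q a l = 0 := by
  rw [← vertex_start_mul_path, ← mul_assoc, vertex_mul_of_ne Q h, zero_mul]

theorem copath_mul_vertex_start (a : V) (l : List E) :
    copath Q a l * vertex Q (start Q a l) = copath Q a l := by
  cases l with
  | nil => exact vertex_mul_self Q a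
  | cons e l => simp only [start, copath, mul_assoc, ghost_mul_src]

theorem copath_mul_vertex_of_ne {a b : V} {l : List E} (h : b ≠ start Q a l) :
    copath Q a l * vertex Q b = 0 := by
  rw [← copath_mul_vertex_start, mul_assoc, vertex_mul_of_ne Q h.symm, mul_zero]

theorem path_mul_vertex (a : V) (l : List E) : path Q a l * vertex Q a = path Q a l := by
  induction l with
  | nil => exact vertex_mul_self Q a
  | cons e l ih => simp only [path, mul_assoc, ih]

theorem vertex_mul_copath (a : V) (l : List E) : vertex Q a * copath Q a l = copath Q a l := by
  induction l with
  | nil => exact vertex_mul_self Q a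
  | cons e l ih => simp only [copath, ← mul_assoc, ih]

/-- At a break in the list, `r(e)` meets a different vertex. Monomials can therefore be formed from
arbitrary lists, the non-paths contributing zero. -/
theorem path_eq_zero {a : V} {l : List E} (h : ¬ IsPath Q a l) : path Q a l = 0 := by
  induction l with
  | nil => exact absurd trivial h
  | cons e l ih =>
    by_cases hl : IsPath Q a l
    · have he : Q.rng e ≠ start Q a l := fun he => h ⟨he, hl⟩
      rw [path, ← edge_mul_rng, mul_assoc, vertex_mul_path_of_ne Q he, mul_zero]
    · rw [path, ih hl, mul_zero]

theorem copath_eq_zero {a : V} {l : List E} (h : ¬ IsPath Q a l) : copath Q a l = 0 := by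
  induction l with
  | nil => exact absurd trivial h
  | cons e l ih =>
    by_cases hl : IsPath Q a l
    · have he : Q.rng e ≠ start Q a l := fun he => h ⟨he, hl⟩
      rw [copath, ← rng_mul_ghost, ← mul_assoc, copath_mul_vertex_of_ne Q he, zero_mul]
    · rw [copath, ih hl, zero_mul]

theorem path_append (a b : V) (l k : List E) (h : start Q b k = a) :
    path Q a l * path Q b k = path Q b (l ++ k) := by
  induction l with
  | nil => rw [← h]; exact vertex_start_mul_path Q b k
  | cons e l ih => rw [path, mul_assoc, ih]; rfl

theorem copath_append (a b : V) (l k : List E) (h : start Q b k = a) :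
    copath Q b k * copath Q a l = copath Q b (l ++ k) := by
  induction l with
  | nil => rw [← h]; exact copath_mul_vertex_start Q b k
  | cons e l ih => rw [copath, ← mul_assoc, ih]; rfl

theorem copath_mul_path_append {a b : V} {l : List E} (k : List E) (hl : IsPath Q a l)
    (h : start Q b k = a) : copath Q a l * path Q b (l ++ k) = path Q b k := by
  induction l with
  | nil => rw [← h]; exact vertex_start_mul_path Q b k
  | cons e l ih =>
    have hs : start Q b (l ++ k) = Q.rng e := by
      rw [hl.1]
      cases l with
      | nil => exact h
      | cons f l => rfl
    calc copath Q a l * ghost Q e * (edge Q e * path Q b (l ++ k))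
        = copath Q a l * ((ghost Q e * edge Q e) * path Q b (l ++ k)) := by
          simp only [mul_assoc]
      _ = copath Q a l * path Q b (l ++ k) := by
          rw [ghost_mul_edge, ← hs, vertex_start_mul_path]
      _ = path Q b k := ih hl.2

theorem copath_mul_path {a : V} {l : List E} (hl : IsPath Q a l) :
    copath Q a l * path Q a l = vertex Q a := by
  have := copath_mul_path_append Q (b := a) [] hl rfl
  rwa [List.append_nil] at this

theorem edge_mul_mono (e : E) (a : V) (α β : List E) :
    edge Q e * mono Q a α β = mono Q a (e :: α) β := by
  rw [mono, ← mul_assoc]; rfl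

theorem path_singleton (e : E) : path Q (Q.rng e) [e] = edge Q e := edge_mul_rng Q e

theorem copath_singleton (e : E) : copath Q (Q.rng e) [e] = ghost Q e := rng_mul_ghost Q e

theorem mono_nil_nil (a : V) : mono Q a [] [] = vertex Q a := vertex_mul_self Q a

theorem mono_singleton_nil (e : E) : mono Q (Q.rng e) [e] [] = edge Q e := by
  rw [mono, path_singleton]; exact edge_mul_rng Q e

theorem mono_nil_singleton (e : E) : mono Q (Q.rng e) [] [e] = ghost Q e := by
  rw [mono, copath_singleton]; exact rng_mul_ghost Q e

/-- The elements `α β*`, together with `0`. -/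
def monos : Set (LPA Q) := {x | x = 0 ∨ ∃ a α β, x = mono Q a α β}

theorem of_mem_monos (x : Gen V E) : of Q x ∈ monos Q := by
  cases x with
  | vertex a => exact .inr ⟨a, [], [], (mono_nil_nil Q a).symm⟩
  | edge e => exact .inr ⟨Q.rng e, [e], [], (mono_singleton_nil Q e).symm⟩
  | ghost e => exact .inr ⟨Q.rng e, [], [e], (mono_nil_singleton Q e).symm⟩

/-- Left multiplication by generators is enough to control all products. The only growth of `β`
occurs when a ghost edge meets an empty `α`. -/
theorem of_mul_mono_mem_monos (x : Gen V E) (a : V) (α β : List E) :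
    of Q x * mono Q a α β ∈ monos Q := by
  have hv (b : V) (α : List E) : vertex Q b * mono Q a α β ∈ monos Q := by
    rw [mono, ← mul_assoc]
    by_cases hb : b = start Q a α
    · rw [hb, vertex_start_mul_path]; exact .inr ⟨a, α, β, rfl⟩
    · rw [vertex_mul_path_of_ne Q hb, zero_mul]; exact .inl rfl
  cases x with
  | vertex b => exact hv b α
  | edge e => exact .inr ⟨a, e :: α, β, edge_mul_mono Q e a α β⟩
  | ghost f =>
    change ghost Q f * _ ∈ _
    cases α with
    | nil =>
      rw [mono, path, vertex_mul_copath]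
      by_cases hf : Q.src f = a
      · refine .inr ⟨Q.rng f, [], β ++ [f], ?_⟩
        rw [mono, path, vertex_mul_copath, ← copath_append Q a (Q.rng f) β [f] hf, copath_singleton]
      · rw [← vertex_mul_copath, ← ghost_mul_src, mul_assoc, ← mul_assoc (vertex Q _),
          vertex_mul_of_ne Q hf, zero_mul, mul_zero]
        exact .inl rfl
    | cons e α =>
      rw [← edge_mul_mono, ← mul_assoc]
      by_cases hf : f = e
      · rw [hf, ghost_mul_edge]; exact hv _ _
      · rw [ghost_mul_edge_of_ne Q hf, zero_mul]; exact .inl rfl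

theorem mem_monos_of_mem_invSemigroup {s : LPA Q} (hs : s ∈ invSemigroup Q) : s ∈ monos Q := by
  -- Carrying stability under left multiplication through the induction avoids computing the product
  -- of two general monomials.
  suffices h : s ∈ monos Q ∧ ∀ t ∈ monos Q, s * t ∈ monos Q from h.1
  induction hs using Subsemigroup.closure_induction with
  | mem x hx =>
    obtain rfl | ⟨x, rfl⟩ := hx
    · exact ⟨.inl rfl, fun t _ => .inl (zero_mul t)⟩
    · refine ⟨of_mem_monos Q x, ?_⟩
      rintro t (rfl | ⟨a, α, β, rfl⟩)
      · exact .inl (mul_zero _)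
      · exact of_mul_mono_mem_monos Q x a α β
  | mul x y _ _ hx hy =>
    exact ⟨hx.2 y hy.1, fun t ht => by rw [mul_assoc]; exact hx.2 _ (hy.2 t ht)⟩

/-- Induction on elements of `L_Q`. -/
theorem induction {P : LPA Q → Prop} (of : ∀ x, P (of Q x)) (zero : P 0)
    (add : ∀ a b, P a → P b → P (a + b)) (mul : ∀ a b, P a → P b → P (a * b))
    (smul : ∀ (z : ℂ) a, P a → P (z • a)) (a : LPA Q) : P a := by
  obtain ⟨a, ha⟩ := a
  induction ha using NonUnitalAlgebra.adjoin_induction with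
  | mem x hx => obtain ⟨x, rfl⟩ := hx; exact of x
  | zero => exact zero
  | add x y hx hy hx' hy' => exact add _ _ hx' hy'
  | mul x y hx hy hx' hy' => exact mul _ _ hx' hy'
  | smul r x hx hx' => exact smul r _ hx'

theorem mem_span_monos (a : LPA Q) : a ∈ Submodule.span ℂ (monos Q) := by
  suffices h : a ∈ Submodule.span ℂ (monos Q) ∧
      ∀ t ∈ Submodule.span ℂ (monos Q), a * t ∈ Submodule.span ℂ (monos Q) from h.1
  induction a using induction with
  | of x =>
    refine ⟨Submodule.subset_span (of_mem_monos Q x), fun t ht => ?_⟩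
    induction ht using Submodule.span_induction with
    | mem t ht =>
      obtain rfl | ⟨a, α, β, rfl⟩ := ht
      · rw [mul_zero]; exact zero_mem _
      · exact Submodule.subset_span (of_mul_mono_mem_monos Q x a α β)
    | zero => rw [mul_zero]; exact zero_mem _
    | add s t _ _ hs ht => rw [mul_add]; exact add_mem hs ht
    | smul z t _ ht => rw [mul_smul_comm]; exact Submodule.smul_mem _ z ht
  | zero => exact ⟨zero_mem _, fun t _ => by rw [zero_mul]; exact zero_mem _⟩
  | add a b ha hb =>
    exact ⟨add_mem ha.1 hb.1, fun t ht => by rw [add_mul]; exact add_mem (ha.2 t ht) (hb.2 t ht)⟩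
  | mul a b ha hb =>
    exact ⟨ha.2 b hb.1, fun t ht => by rw [mul_assoc]; exact ha.2 _ (hb.2 t ht)⟩
  | smul z a ha =>
    exact ⟨Submodule.smul_mem _ z ha.1, fun t ht => by
      rw [smul_mul_assoc]; exact Submodule.smul_mem _ z (ha.2 t ht)⟩

/-- Inserting the relation at the regular vertex `a` between `α` and `β*` lengthens both paths by
one edge. -/
theorem mono_eq_sum {a : V} (h : Q.IsRegular a) (α β : List E) :
    mono Q a α β = ∑ e ∈ h.1.toFinset, mono Q (Q.rng e) (α ++ [e]) (β ++ [e]) := by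
  rw [mono, ← path_mul_vertex, vertex_eq_sum Q a h, Finset.mul_sum, Finset.sum_mul]
  refine Finset.sum_congr rfl fun e he => ?_
  have hs : Q.src e = a := h.1.mem_toFinset.1 he
  rw [mono, ← path_append Q a _ α [e] hs, ← copath_append Q a _ β [e] hs, path_singleton,
    copath_singleton]
  simp only [mul_assoc]

/-- Triples `(a, α, β)` of a vertex and two paths ending there, with `β` of length `n`, or shorter
with `a` singular. -/
def reduced (n : ℕ) : Set (V × List E × List E) :=
  {t | IsPath Q t.1 t.2.1 ∧ IsPath Q t.1 t.2.2 ∧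
    (t.2.2.length = n ∨ (t.2.2.length < n ∧ ¬ Q.IsRegular t.1))}

/-- Each expansion at a regular end vertex lowers the deficit `n - |β|` by one; at a singular end
vertex the monomial is already reduced. -/
theorem mono_mem_span_reduced (n : ℕ) (a : V) (α β : List E) (h : β.length ≤ n) :
    mono Q a α β ∈ Submodule.span ℂ
      ((fun t : V × List E × List E => mono Q t.1 t.2.1 t.2.2) '' reduced Q n) := by
  induction hk : n - β.length generalizing a α β with
  | zero =>
    by_cases hα : IsPath Q a α
    · by_cases hβ : IsPath Q a β
      · exact Submodule.subset_span ⟨(a, α, β), ⟨hα, hβ, .inl (by simp only; omega)⟩, rfl⟩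
      · rw [mono, copath_eq_zero Q hβ, mul_zero]; exact zero_mem _
    · rw [mono, path_eq_zero Q hα, zero_mul]; exact zero_mem _
  | succ k ih =>
    by_cases ha : Q.IsRegular a
    · rw [mono_eq_sum Q ha]
      refine Submodule.sum_mem _ fun e _ => ih _ _ _ ?_ ?_ <;>
        rw [List.length_append, List.length_singleton] <;> omega
    · by_cases hα : IsPath Q a α
      · by_cases hβ : IsPath Q a β
        · exact Submodule.subset_span
            ⟨(a, α, β), ⟨hα, hβ, .inr ⟨by simp only; omega, ha⟩⟩, rfl⟩
        · rw [mono, copath_eq_zero Q hβ, mul_zero]; exact zero_mem _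
      · rw [mono, path_eq_zero Q hα, zero_mul]; exact zero_mem _

theorem exists_mem_span_reduced (a : LPA Q) : ∃ n, a ∈ Submodule.span ℂ
    ((fun t : V × List E × List E => mono Q t.1 t.2.1 t.2.2) '' reduced Q n) := by
  -- All large `n` are needed so that the two terms of a sum can share one length.
  suffices h : ∃ m, ∀ n ≥ m, a ∈ Submodule.span ℂ
      ((fun t : V × List E × List E => mono Q t.1 t.2.1 t.2.2) '' reduced Q n) from
    h.imp fun m hm => hm m le_rfl
  induction mem_span_monos Q a using Submodule.span_induction with
  | mem x hx =>
    obtain rfl | ⟨a, α, β, rfl⟩ := hx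
    · exact ⟨0, fun n _ => zero_mem _⟩
    · exact ⟨β.length, fun n hn => mono_mem_span_reduced Q n a α β hn⟩
  | zero => exact ⟨0, fun n _ => zero_mem _⟩
  | add x y _ _ hx hy =>
    obtain ⟨m, hm⟩ := hx
    obtain ⟨k, hk⟩ := hy
    exact ⟨max m k, fun n hn => add_mem (hm n (le_trans (le_max_left _ _) hn))
      (hk n (le_trans (le_max_right _ _) hn))⟩
  | smul z x _ hx =>
    obtain ⟨m, hm⟩ := hx
    exact ⟨m, fun n hn => Submodule.smul_mem _ z (hm n hn)⟩

theorem isPath_append {a b : V} {l k : List E} (hl : IsPath Q a l) (hk : IsPath Q b k)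
    (h : start Q b k = a) : IsPath Q b (l ++ k) := by
  induction l with
  | nil => exact hk
  | cons e l ih =>
    refine ⟨?_, ih hl.2⟩
    rw [hl.1]
    cases l with
    | nil => exact h.symm
    | cons f l => rfl

theorem isPath_of_append {a : V} {l k : List E} (h : IsPath Q a (l ++ k)) : IsPath Q a k := by
  induction l with
  | nil => exact h
  | cons e l ih => exact ih h.2

theorem path_mem_invSemigroup (a : V) (l : List E) : path Q a l ∈ invSemigroup Q := by
  induction l with
  | nil => exact (invSemigroup.of Q (.vertex a)).2
  | cons e l ih => exact mul_mem (invSemigroup.of Q (.edge e)).2 ih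

theorem copath_mem_invSemigroup (a : V) (l : List E) : copath Q a l ∈ invSemigroup Q := by
  induction l with
  | nil => exact (invSemigroup.of Q (.vertex a)).2
  | cons e l ih => exact mul_mem ih (invSemigroup.of Q (.ghost e)).2

theorem mono_mem_invSemigroup (a : V) (α β : List E) : mono Q a α β ∈ invSemigroup Q :=
  mul_mem (path_mem_invSemigroup Q a α) (copath_mem_invSemigroup Q a β)

/-- The representation of `L_Q` given by operators satisfying the defining relations. -/
def lift {A : Type w} [Ring A] [Algebra ℂ A] (T : Gen V E → A)
    (hT : ∀ x y, Rel Q x y → FreeAlgebra.lift ℂ T x = FreeAlgebra.lift ℂ T y) : LPA Q →ₙₐ[ℂ] A :=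
  ((RingQuot.liftAlgHom ℂ ⟨FreeAlgebra.lift ℂ T, hT⟩ : UnitalLeavitt Q →ₐ[ℂ] A) :
    UnitalLeavitt Q →ₙₐ[ℂ] A).comp (NonUnitalSubalgebraClass.subtype _)

theorem lift_of {A : Type w} [Ring A] [Algebra ℂ A] (T : Gen V E → A)
    (hT : ∀ x y, Rel Q x y → FreeAlgebra.lift ℂ T x = FreeAlgebra.lift ℂ T y) (x : Gen V E) :
    lift Q T hT (of Q x) = T x := by
  change RingQuot.liftAlgHom ℂ _ (RingQuot.mkAlgHom ℂ (Rel Q) (FreeAlgebra.ι ℂ x)) = T x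
  rw [RingQuot.liftAlgHom_mkAlgHom_apply, FreeAlgebra.lift_ι_apply]

end LPA

/-! ## Partial injections as operators on functions -/

section PEquiv

variable {N : Type w}

theorem pequiv_ext {f g : N ≃. N} (h : ∀ x y, y ∈ f x ↔ y ∈ g x) : f = g :=
  PEquiv.ext fun x => Option.ext fun y => h x y

open Classical in
/-- The partial injection given by a function injective on a set. -/
def pequivOfInjOn (D : Set N) (g : N → N) (h : Set.InjOn g D) : N ≃. N where
  toFun x := if x ∈ D then some (g x) else none
  invFun z := if hz : ∃ x ∈ D, g x = z then some hz.choose else none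
  inv x z := by
    constructor
    · intro hx
      by_cases hz : ∃ x ∈ D, g x = z
      · rw [dif_pos hz, Option.some_inj] at hx
        rw [← hx, if_pos hz.choose_spec.1, hz.choose_spec.2]
      · rw [dif_neg hz] at hx
        cases hx
    · intro hx
      by_cases hD : x ∈ D
      · rw [if_pos hD, Option.some_inj] at hx
        have hz : ∃ x ∈ D, g x = z := ⟨x, hD, hx⟩
        rw [dif_pos hz, Option.some_inj]
        exact h hz.choose_spec.1 hD (hz.choose_spec.2.trans hx.symm)
      · rw [if_neg hD] at hx
        cases hx

theorem mem_pequivOfInjOn {D : Set N} {g : N → N} {h : Set.InjOn g D} {x z : N} :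
    z ∈ pequivOfInjOn D g h x ↔ x ∈ D ∧ g x = z := by
  classical
  change z ∈ (if x ∈ D then some (g x) else none) ↔ _
  by_cases hx : x ∈ D <;> simp [hx]

/-- The operator on functions induced by a partial injection. -/
def lin (f : N ≃. N) : Module.End ℂ (N → ℂ) where
  toFun ξ y := (f.symm y).elim 0 ξ
  map_add' ξ η := by
    ext y
    simp only [Pi.add_apply]
    cases f.symm y <;> simp
  map_smul' z ξ := by
    ext y
    simp only [Pi.smul_apply, RingHom.id_apply]
    cases f.symm y <;> simp

theorem lin_apply (f : N ≃. N) (ξ : N → ℂ) (y : N) : lin f ξ y = (f.symm y).elim 0 ξ := rfl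

theorem lin_apply_of_mem {f : N ≃. N} {x y : N} (h : y ∈ f x) (ξ : N → ℂ) :
    lin f ξ y = ξ x := by
  rw [lin_apply, (f.mem_iff_mem.2 h : f.symm y = some x)]
  rfl

theorem lin_apply_of_notMem {f : N ≃. N} {y : N} (h : ∀ x, y ∉ f x) (ξ : N → ℂ) :
    lin f ξ y = 0 := by
  rw [lin_apply]
  cases hy : f.symm y with
  | none => rfl
  | some x => exact absurd (f.mem_iff_mem.1 hy) (h x)

theorem notMem_bot (x y : N) : y ∉ (⊥ : N ≃. N) x := nofun

theorem lin_single [DecidableEq N] (f : N ≃. N) (x y : N) [Decidable (y ∈ f x)] :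
    lin f (Pi.single x 1) y = if y ∈ f x then 1 else 0 := by
  by_cases h : ∃ x', y ∈ f x'
  · obtain ⟨x', hx'⟩ := h
    rw [lin_apply_of_mem hx']
    by_cases hx : x' = x
    · rw [hx, Pi.single_eq_same, if_pos (hx ▸ hx')]
    · rw [Pi.single_eq_of_ne hx, if_neg fun h => hx (f.inj hx' h)]
  · push Not at h
    rw [lin_apply_of_notMem h, if_neg (h x)]

/-- Delta functions recover the partial injection. Identities between partial injections can thus be
read off from `L_Q`-linear ones. -/
theorem lin_injective : Function.Injective (lin : (N ≃. N) → _) := by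
  classical
  refine fun f g h => pequiv_ext fun x y => ?_
  have := congrFun (LinearMap.congr_fun h (Pi.single x 1)) y
  rw [lin_single, lin_single] at this
  by_cases h1 : y ∈ f x <;> by_cases h2 : y ∈ g x <;> simp_all

theorem lin_trans (f g : N ≃. N) : lin (f.trans g) = lin g * lin f := by
  ext ξ y
  rw [Module.End.mul_apply, lin_apply, lin_apply (f := g), PEquiv.symm_trans_rev]
  cases h : g.symm y with
  | none => simp [PEquiv.trans, h]
  | some x => simp [PEquiv.trans, h, lin_apply]

theorem lin_bot : lin (⊥ : N ≃. N) = 0 := by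
  ext ξ y
  exact lin_apply_of_notMem (fun x => notMem_bot x y) ξ

end PEquiv

/-! ## Branching systems -/

/-- A branching system of the graph `Q`: a set `N`, partitioned into sets `N_a` indexed by the
vertices, with injections `N_{r(e)} → N_{s(e)}` with disjoint ranges, that cover `N_a` if `a` is
regular. -/
structure BranchingSystem (Q : OrientedGraph V E) (N : Type w) where
  /-- the vertex `a` with `x ∈ N_a` -/
  vtx : N → V
  /-- the injection given by an edge, with an arbitrary value outside its domain -/
  edge : E → N → N
  vtx_edge : ∀ e x, vtx x = Q.rng e → vtx (edge e x) = Q.src e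
  edge_inj : ∀ e f x y, vtx x = Q.rng e → vtx y = Q.rng f → edge e x = edge f y → e = f ∧ x = y
  exists_edge : ∀ z, Q.IsRegular (vtx z) → ∃ e x, vtx x = Q.rng e ∧ edge e x = z

namespace BranchingSystem

variable {Q : OrientedGraph V E} {N : Type w} (B : BranchingSystem Q N)

/-- The partial injection given by a vertex. -/
def vertexEquiv (a : V) : N ≃. N := pequivOfInjOn {x | B.vtx x = a} id Function.injective_id.injOn

/-- The partial injection given by an edge. -/
def edgeEquiv (e : E) : N ≃. N :=
  pequivOfInjOn {x | B.vtx x = Q.rng e} (B.edge e)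
    fun x hx y hy h => (B.edge_inj e e x y hx hy h).2

/-- The partial injection given by a generator. -/
def genEquiv : Gen V E → (N ≃. N)
  | .vertex a => B.vertexEquiv a
  | .edge e => B.edgeEquiv e
  | .ghost e => (B.edgeEquiv e).symm

variable {B}

theorem mem_vertexEquiv {a : V} {x y : N} : y ∈ B.vertexEquiv a x ↔ B.vtx x = a ∧ x = y :=
  mem_pequivOfInjOn

theorem mem_edgeEquiv {e : E} {x y : N} :
    y ∈ B.edgeEquiv e x ↔ B.vtx x = Q.rng e ∧ B.edge e x = y :=
  mem_pequivOfInjOn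

theorem mem_edgeEquiv_symm {e : E} {x y : N} :
    y ∈ (B.edgeEquiv e).symm x ↔ B.vtx y = Q.rng e ∧ B.edge e y = x :=
  (B.edgeEquiv e).mem_iff_mem.trans mem_edgeEquiv

variable (B)

/-- A point over a regular vertex lies in the range of exactly one edge, so a single summand
survives there. -/
theorem lin_ck2 (a : V) (h : Q.IsRegular a) :
    lin (B.vertexEquiv a) =
      ∑ e ∈ h.1.toFinset, lin (B.edgeEquiv e) * lin (B.edgeEquiv e).symm := by
  ext ξ z
  rw [LinearMap.sum_apply, Finset.sum_apply]
  by_cases hz : B.vtx z = a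
  · obtain ⟨e, x, hx, rfl⟩ := B.exists_edge z (hz ▸ h)
    have hm : B.edge e x ∈ B.edgeEquiv e x := mem_edgeEquiv.2 ⟨hx, rfl⟩
    rw [lin_apply_of_mem (mem_vertexEquiv.2 ⟨hz, rfl⟩), Finset.sum_eq_single e]
    · rw [Module.End.mul_apply, lin_apply_of_mem hm,
        lin_apply_of_mem ((B.edgeEquiv e).mem_iff_mem.2 hm)]
    · intro f _ hf
      rw [Module.End.mul_apply, lin_apply_of_notMem]
      intro y hy
      obtain ⟨hy, h⟩ := mem_edgeEquiv.1 hy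
      exact hf (B.edge_inj f e y x hy hx h).1
    · intro he
      exact absurd (h.1.mem_toFinset.2 ((B.vtx_edge e x hx).symm.trans hz)) he
  · rw [lin_apply_of_notMem, Finset.sum_eq_zero]
    · intro e he
      rw [Module.End.mul_apply, lin_apply_of_notMem]
      intro y hy
      obtain ⟨hv, rfl⟩ := mem_edgeEquiv.1 hy
      exact hz ((B.vtx_edge e y hv).trans (h.1.mem_toFinset.1 he))
    · intro x hx
      obtain ⟨hv, rfl⟩ := mem_vertexEquiv.1 hx
      exact hz hv

theorem lift_lin_eq_of_rel (x y : FreeAlgebra ℂ (Gen V E)) (h : Rel Q x y) :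
    FreeAlgebra.lift ℂ (fun g => lin (B.genEquiv g)) x =
      FreeAlgebra.lift ℂ (fun g => lin (B.genEquiv g)) y := by
  cases h with
  | ck2 a h =>
    simp only [map_sum, map_mul, FreeAlgebra.lift_ι_apply]
    exact B.lin_ck2 a h
  | vertex_mul_self a =>
    simp only [map_mul, FreeAlgebra.lift_ι_apply, ← lin_trans]
    congr 1
    refine pequiv_ext fun x y => ?_
    simp only [genEquiv, PEquiv.mem_trans, mem_vertexEquiv]
    grind
  | vertex_mul_of_ne a b h =>
    simp only [map_mul, FreeAlgebra.lift_ι_apply, ← lin_trans, map_zero]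
    rw [← lin_bot]
    congr 1
    refine pequiv_ext fun x y => ?_
    simp only [genEquiv, PEquiv.mem_trans, mem_vertexEquiv, notMem_bot]
    grind
  | src_mul_edge e =>
    simp only [map_mul, FreeAlgebra.lift_ι_apply, ← lin_trans]
    congr 1
    refine pequiv_ext fun x y => ?_
    simp only [genEquiv, PEquiv.mem_trans, mem_vertexEquiv, mem_edgeEquiv]
    have := B.vtx_edge e
    grind
  | edge_mul_rng e =>
    simp only [map_mul, FreeAlgebra.lift_ι_apply, ← lin_trans]
    congr 1
    refine pequiv_ext fun x y => ?_
    simp only [genEquiv, PEquiv.mem_trans, mem_vertexEquiv, mem_edgeEquiv]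
    grind
  | rng_mul_ghost e =>
    simp only [map_mul, FreeAlgebra.lift_ι_apply, ← lin_trans]
    congr 1
    refine pequiv_ext fun x y => ?_
    simp only [genEquiv, PEquiv.mem_trans, mem_vertexEquiv, mem_edgeEquiv_symm]
    grind
  | ghost_mul_src e =>
    simp only [map_mul, FreeAlgebra.lift_ι_apply, ← lin_trans]
    congr 1
    refine pequiv_ext fun x y => ?_
    simp only [genEquiv, PEquiv.mem_trans, mem_vertexEquiv, mem_edgeEquiv_symm]
    have := B.vtx_edge e
    grind
  | ck1_self e =>
    simp only [map_mul, FreeAlgebra.lift_ι_apply, ← lin_trans]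
    congr 1
    refine pequiv_ext fun x y => ?_
    simp only [genEquiv, PEquiv.mem_trans, mem_vertexEquiv, mem_edgeEquiv, mem_edgeEquiv_symm]
    have := B.edge_inj e e
    grind
  | ck1_of_ne e f h =>
    simp only [map_mul, FreeAlgebra.lift_ι_apply, ← lin_trans, map_zero]
    rw [← lin_bot]
    congr 1
    refine pequiv_ext fun x y => ?_
    simp only [genEquiv, PEquiv.mem_trans, mem_edgeEquiv, mem_edgeEquiv_symm, notMem_bot]
    have := B.edge_inj e f
    grind

/-- The representation of `L_Q` on functions on a branching system. -/
def rep : LPA Q →ₙₐ[ℂ] Module.End ℂ (N → ℂ) :=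
  LPA.lift Q (fun g => lin (B.genEquiv g)) B.lift_lin_eq_of_rel

theorem rep_of (g : Gen V E) : B.rep (LPA.of Q g) = lin (B.genEquiv g) := LPA.lift_of Q _ _ g

/-- An element of `S(Q)` may have several expressions in the generators. Its image in the linear
representation does not depend on the expression, so together with `lin_injective` this makes the
action well defined. -/
theorem exists_rep_eq_lin {s : LPA Q} (hs : s ∈ invSemigroup Q) : ∃ f, B.rep s = lin f := by
  induction hs using Subsemigroup.closure_induction with
  | mem x hx =>
    obtain rfl | ⟨g, rfl⟩ := hx
    · exact ⟨⊥, by rw [map_zero, lin_bot]⟩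
    · exact ⟨_, B.rep_of g⟩
  | mul x y _ _ hx hy =>
    obtain ⟨f, hf⟩ := hx
    obtain ⟨g, hg⟩ := hy
    exact ⟨g.trans f, by rw [map_mul, hf, hg, lin_trans]⟩

theorem rep_eq_lin_choose (s : invSemigroup Q) :
    B.rep s = lin (B.exists_rep_eq_lin s.2).choose := (B.exists_rep_eq_lin s.2).choose_spec

/-- The action of the inverse semigroup on a branching system. -/
def action : PartialAction Q N where
  toFun s := (B.exists_rep_eq_lin s.2).choose
  map_mul' s t := lin_injective <| by
    rw [lin_trans, ← rep_eq_lin_choose, ← rep_eq_lin_choose, ← rep_eq_lin_choose, ← map_mul]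
    rfl
  map_zero' := lin_injective <| by
    rw [← rep_eq_lin_choose, lin_bot]
    exact map_zero B.rep

theorem rep_eq_lin (s : invSemigroup Q) : B.rep s = lin (B.action.toFun s) :=
  B.rep_eq_lin_choose s

theorem action_eq {s : invSemigroup Q} {f : N ≃. N} (h : B.rep s = lin f) :
    B.action.toFun s = f :=
  lin_injective ((B.rep_eq_lin s).symm.trans h)

theorem action_of (g : Gen V E) : B.action.toFun (invSemigroup.of Q g) = B.genEquiv g :=
  B.action_eq (B.rep_of g)

theorem vertexSet_action (a : V) : B.action.vertexSet a = {x | B.vtx x = a} := by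
  ext x
  simp only [PartialAction.vertexSet, action_of, genEquiv, Set.mem_ofPred_eq, ← Option.mem_def,
    mem_vertexEquiv]
  exact ⟨fun ⟨y, h, _⟩ => h, fun h => ⟨x, h, rfl⟩⟩

theorem edgeSet_action (e : E) :
    B.action.edgeSet e = {z | ∃ x, B.vtx x = Q.rng e ∧ B.edge e x = z} := by
  ext x
  simp only [PartialAction.edgeSet, action_of, genEquiv, Set.mem_ofPred_eq, ← Option.mem_def,
    mem_edgeEquiv]

theorem isTight_action : B.action.IsTight where
  disjoint_vertexSet a b h := by
    simp only [vertexSet_action, vertexSet_action]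
    exact Set.disjoint_left.2 fun x hx hy => h (hx.symm.trans hy)
  iUnion_vertexSet := by
    simp only [vertexSet_action]
    exact Set.eq_univ_of_forall fun x => Set.mem_iUnion.2 ⟨B.vtx x, rfl⟩
  disjoint_edgeSet a _ e _ f _ h := by
    simp only [edgeSet_action, edgeSet_action]
    refine Set.disjoint_left.2 ?_
    rintro z ⟨x, hx, rfl⟩ ⟨y, hy, hxy⟩
    exact h (B.edge_inj f e y x hy hx hxy).1.symm
  iUnion_edgeSet a ha := by
    ext z
    simp only [vertexSet_action, edgeSet_action, Set.mem_iUnion, Set.mem_ofPred_eq]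
    constructor
    · rintro rfl
      obtain ⟨e, x, hx, rfl⟩ := B.exists_edge z ha
      exact ⟨e, (B.vtx_edge e x hx).symm, x, hx, rfl⟩
    · rintro ⟨e, rfl, x, hx, rfl⟩
      exact B.vtx_edge e x hx

/-! ### The action of paths -/

/-- The action of a list of edges. -/
def act (l : List E) (y : N) : N := l.foldr B.edge y

theorem act_append (l k : List E) (y : N) : B.act (l ++ k) y = B.act l (B.act k y) :=
  List.foldr_append

variable {B}

theorem vtx_act {a : V} {l : List E} {y : N} (hl : LPA.IsPath Q a l) (hy : B.vtx y = a) :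
    B.vtx (B.act l y) = LPA.start Q a l := by
  induction l with
  | nil => exact hy
  | cons e l ih => exact B.vtx_edge e _ ((ih hl.2).trans hl.1.symm)

/-- Disjointness of edge ranges identifies the leading edges, and injectivity strips them off one at
a time. -/
theorem act_prefix {a b : V} {l k : List E} {y z : N} (hl : LPA.IsPath Q a l) (hy : B.vtx y = a)
    (hk : LPA.IsPath Q b k) (hz : B.vtx z = b) (hlk : l.length ≤ k.length)
    (h : B.act l y = B.act k z) : ∃ m, k = l ++ m ∧ y = B.act m z := by
  induction l generalizing k with
  | nil => exact ⟨k, rfl, h⟩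
  | cons e l ih =>
    cases k with
    | nil => simp at hlk
    | cons f k =>
      obtain ⟨rfl, h'⟩ := B.edge_inj e f _ _ ((vtx_act hl.2 hy).trans hl.1.symm)
        ((vtx_act hk.2 hz).trans hk.1.symm) h
      obtain ⟨m, rfl, hm⟩ := ih hl.2 hk.2 (by simpa using hlk) h'
      exact ⟨m, rfl, hm⟩

theorem act_eq_of_length_eq {a b : V} {l k : List E} {y z : N} (hl : LPA.IsPath Q a l)
    (hy : B.vtx y = a) (hk : LPA.IsPath Q b k) (hz : B.vtx z = b) (hlk : l.length = k.length)
    (h : B.act l y = B.act k z) : l = k ∧ y = z := by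
  obtain ⟨m, rfl, hm⟩ := act_prefix hl hy hk hz hlk.le h
  have : m = [] := by simpa using hlk
  subst this
  exact ⟨(List.append_nil l).symm, hm⟩

variable (B)

theorem exists_rep_path (a : V) (l : List E) : ∃ f, B.rep (LPA.path Q a l) = lin f ∧
    B.rep (LPA.copath Q a l) = lin f.symm ∧
    ∀ y z, z ∈ f y ↔ LPA.IsPath Q a l ∧ B.vtx y = a ∧ B.act l y = z := by
  induction l with
  | nil =>
    refine ⟨B.vertexEquiv a, B.rep_of _, (B.rep_of _).trans (congrArg lin ?_), fun y z => ?_⟩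
    · refine pequiv_ext fun x y => ?_
      rw [PEquiv.mem_iff_mem, genEquiv, mem_vertexEquiv, mem_vertexEquiv]
      grind
    · rw [mem_vertexEquiv]
      exact ⟨fun h => ⟨trivial, h⟩, fun h => h.2⟩
  | cons e l ih =>
    obtain ⟨f, hf, hf', h⟩ := ih
    refine ⟨f.trans (B.edgeEquiv e), ?_, ?_, fun y z => ?_⟩
    · rw [lin_trans, ← hf, LPA.path, map_mul]
      exact congrArg (· * _) (B.rep_of _)
    · rw [PEquiv.symm_trans_rev, lin_trans, ← hf', LPA.copath, map_mul]
      exact congrArg (_ * ·) (B.rep_of _)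
    · rw [PEquiv.mem_trans]
      constructor
      · rintro ⟨x, hx, hz⟩
        obtain ⟨hl, hy, rfl⟩ := (h y x).1 hx
        obtain ⟨hr, rfl⟩ := mem_edgeEquiv.1 hz
        exact ⟨⟨hr.symm.trans (vtx_act hl hy), hl⟩, hy, rfl⟩
      · rintro ⟨hl, hy, rfl⟩
        exact ⟨_, (h y _).2 ⟨hl.2, hy, rfl⟩,
          mem_edgeEquiv.2 ⟨(vtx_act hl.2 hy).trans hl.1.symm, rfl⟩⟩

theorem exists_rep_mono (a : V) (α β : List E) : ∃ f, B.rep (LPA.mono Q a α β) = lin f ∧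
    ∀ x z, z ∈ f x ↔ LPA.IsPath Q a α ∧ LPA.IsPath Q a β ∧
      ∃ y, B.vtx y = a ∧ B.act β y = x ∧ B.act α y = z := by
  obtain ⟨f, hf, -, h⟩ := B.exists_rep_path a α
  obtain ⟨g, -, hg, h'⟩ := B.exists_rep_path a β
  refine ⟨g.symm.trans f, by rw [lin_trans, ← hf, ← hg, LPA.mono, map_mul], fun x z => ?_⟩
  simp only [PEquiv.mem_trans, PEquiv.mem_iff_mem, h, h']
  grind

theorem mem_action_mono {s : invSemigroup Q} {a : V} {α β : List E} (hs : s.1 = LPA.mono Q a α β)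
    {x z : N} : z ∈ B.action.toFun s x ↔ LPA.IsPath Q a α ∧ LPA.IsPath Q a β ∧
      ∃ y, B.vtx y = a ∧ B.act β y = x ∧ B.act α y = z := by
  obtain ⟨f, hf, h⟩ := B.exists_rep_mono a α β
  rw [B.action_eq ((congrArg B.rep hs).trans hf), h]

/-! ### Faithful branching systems -/

/-- Every set `N_a` is nonempty, and not covered by the ranges of the injections if `a` is
singular; there is a degree function that is increased by one by every injection. -/
structure IsFaithful : Prop where
  exists_vtx : ∀ a, ∃ y, B.vtx y = a ∧
    (¬ Q.IsRegular a → ∀ e x, B.vtx x = Q.rng e → B.edge e x ≠ y)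
  exists_degree : ∃ d : N → ℤ, ∀ e x, B.vtx x = Q.rng e → d (B.edge e x) = d x + 1

variable {B}

theorem degree_act {d : N → ℤ} (hd : ∀ e x, B.vtx x = Q.rng e → d (B.edge e x) = d x + 1)
    {a : V} {l : List E} {y : N} (hl : LPA.IsPath Q a l) (hy : B.vtx y = a) :
    d (B.act l y) = d y + l.length := by
  induction l with
  | nil => simp [act]
  | cons e l ih =>
    have := hd e (B.act l y) ((vtx_act hl.2 hy).trans hl.1.symm)
    rw [ih hl.2] at this
    simp only [List.length_cons, Nat.cast_add, Nat.cast_one, ← add_assoc]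
    exact this

/-- The paths occurring in the action on `β y` of reduced elements are determined by `y` and
the image. -/
theorem IsFaithful.eq_of_act_eq {d : N → ℤ}
    (hd : ∀ e x, B.vtx x = Q.rng e → d (B.edge e x) = d x + 1) {n : ℕ} {a b : V}
    {α β α' β' : List E} (ht : (a, α, β) ∈ LPA.reduced Q n) (ht' : (b, α', β') ∈ LPA.reduced Q n)
    {y z : N} (hy : B.vtx y = a)
    (hs : ¬ Q.IsRegular a → ∀ e x, B.vtx x = Q.rng e → B.edge e x ≠ y) (hz : B.vtx z = b)
    (hβ : B.act β y = B.act β' z) (hα : B.act α y = B.act α' z) (hl : β.length ≤ β'.length) :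
    (a, α, β) = (b, α', β') := by
  obtain ⟨h1, h2, h3⟩ := ht
  obtain ⟨h1', h2', h3'⟩ := ht'
  simp only at h1 h2 h3 h1' h2' h3'
  obtain ⟨m, rfl, hm⟩ := act_prefix h2 hy h2' hz hl hβ
  -- If `m` were nonempty, either `β'` would be longer than `n`, or `a` would be singular and `y`
  -- would lie in the range of an edge.
  have hm0 : m = [] := by
    cases m with
    | nil => rfl
    | cons e m =>
      have hp := LPA.isPath_of_append Q h2'
      obtain h3 | h3 := h3
      · simp only [List.length_append, List.length_cons] at h3'
        omega
      · exact absurd hm.symm (hs h3.2 e _ ((vtx_act hp.2 hz).trans hp.1.symm))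
  subst hm0
  obtain rfl : y = z := hm
  obtain rfl : a = b := hy.symm.trans hz
  -- Both paths lead from the same point to the same point, so the degree gives them equal length.
  have hlen : α.length = α'.length := by
    have := congrArg d hα
    rw [degree_act hd h1 hy, degree_act hd h1' hy] at this
    omega
  rw [(act_eq_of_length_eq h1 hy h1' hy hlen hα).1, List.append_nil]

/-- Coefficients are killed by strong induction on `|β|`: evaluating at `αy` the image of the delta
function at `βy` leaves only the coefficient of `αβ*`, by `eq_of_act_eq`. -/
theorem IsFaithful.eq_zero (hB : B.IsFaithful) {a : LPA Q} [DecidableEq N]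
    (ha : ∀ x, B.rep a (Pi.single x 1) = 0) : a = 0 := by
  classical
  obtain ⟨n, hn⟩ := LPA.exists_mem_span_reduced Q a
  obtain ⟨c, hc, rfl⟩ := (Finsupp.mem_span_image_iff_linearCombination ℂ).1 hn
  obtain ⟨d, hd⟩ := hB.exists_degree
  suffices h : ∀ k, ∀ t, t.2.2.length = k → c t = 0 by
    rw [show c = 0 from Finsupp.ext fun t => h _ t rfl, map_zero]
  intro k
  induction k using Nat.strong_induction_on with
  | _ k ih =>
    rintro ⟨v, α, β⟩ hk
    by_contra hct
    have ht : (v, α, β) ∈ LPA.reduced Q n := hc (Finsupp.mem_support_iff.2 hct)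
    obtain ⟨y, hy, hys⟩ := hB.exists_vtx v
    have h0 := congrFun (ha (B.act β y)) (B.act α y)
    rw [Finsupp.linearCombination_apply, Finsupp.sum, map_sum, LinearMap.sum_apply,
      Finset.sum_apply, Finset.sum_eq_single (v, α, β)] at h0
    · obtain ⟨f, hf, hmem⟩ := B.exists_rep_mono v α β
      rw [map_smul, LinearMap.smul_apply, Pi.smul_apply, hf, lin_single, if_pos ((hmem _ _).2 ⟨ht.1, ht.2.1, y, hy, rfl, rfl⟩)] at h0
      exact hct (by simpa using h0)
    · rintro ⟨w, α', β'⟩ ht' hne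
      have hct' := Finsupp.mem_support_iff.1 ht'
      obtain ⟨f, hf, hmem⟩ := B.exists_rep_mono w α' β'
      rw [map_smul, LinearMap.smul_apply, Pi.smul_apply, hf, lin_single, if_neg, smul_zero]
      intro hmm
      obtain ⟨-, -, z, hz, hβ, hα⟩ := (hmem _ _).1 hmm
      refine hne (IsFaithful.eq_of_act_eq hd ht (hc ht') hy hys hz hβ.symm hα.symm ?_).symm
      -- A strictly shorter `β'` has zero coefficient by induction, hence is not in the support.
      by_contra hlt
      exact hct' (ih β'.length (by simp only at hk; omega) _ rfl)
    · intro h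
      exact absurd (Finsupp.notMem_support_iff.1 h) hct

/-- The action on a faithful branching system is free modulo idempotents: elements with the same
value at a point agree after multiplication by an idempotent defined at the point. -/
theorem IsFaithful.exists_idempotent (hB : B.IsFaithful) {s t : invSemigroup Q} {x z : N}
    (hs : z ∈ B.action.toFun s x) (ht : z ∈ B.action.toFun t x) :
    ∃ f : invSemigroup Q, f * f = f ∧ (∃ y, B.action.toFun f x = some y) ∧ s * f = t * f := by
  obtain ⟨d, hd⟩ := hB.exists_degree
  have hform (s : invSemigroup Q) (hs : z ∈ B.action.toFun s x) :
      ∃ a α β, s.1 = LPA.mono Q a α β := by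
    refine (LPA.mem_monos_of_mem_invSemigroup Q s.2).resolve_left fun h => ?_
    rw [B.action_eq (f := ⊥) (by rw [h, map_zero, lin_bot])] at hs
    exact notMem_bot x z hs
  obtain ⟨a, α, β, hsm⟩ := hform s hs
  obtain ⟨b, γ, δ, htm⟩ := hform t ht
  obtain ⟨hα, hβ, y, hy, hyx, hyz⟩ := (B.mem_action_mono hsm).1 hs
  obtain ⟨hγ, hδ, y', hy', hyx', hyz'⟩ := (B.mem_action_mono htm).1 ht
  -- By symmetry `|β| ≤ |δ|`, so `δ = βm`. The degree forces `αm = γ`, and the idempotent `δδ*`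
  -- turns both `αβ*` and `γδ*` into `γδ*`.
  have key (s t : invSemigroup Q) {a b : V} {α β γ δ : List E} (hsm : s.1 = LPA.mono Q a α β)
      (htm : t.1 = LPA.mono Q b γ δ) (hα : LPA.IsPath Q a α) (hβ : LPA.IsPath Q a β)
      (hγ : LPA.IsPath Q b γ) (hδ : LPA.IsPath Q b δ) {y y' : N}
      (hy : B.vtx y = a) (hy' : B.vtx y' = b) (h1 : B.act β y = x) (h1' : B.act δ y' = x)
      (h2 : B.act α y = z) (h2' : B.act γ y' = z) (hlen : β.length ≤ δ.length) :
      ∃ f : invSemigroup Q, f * f = f ∧ (∃ y, B.action.toFun f x = some y) ∧ s * f = t * f := by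
    obtain ⟨m, rfl, rfl⟩ := act_prefix hβ hy hδ hy' hlen (h1.trans h1'.symm)
    have hm := LPA.isPath_of_append Q hδ
    have hstart : LPA.start Q b m = a := (vtx_act hm hy').symm.trans hy
    have hαm := LPA.isPath_append Q hα hm hstart
    have hz : B.act (α ++ m) y' = B.act γ y' := by rw [act_append, h2, h2']
    have hαγ : α ++ m = γ := by
      refine (act_eq_of_length_eq hαm hy' hγ hy' ?_ hz).1
      have := congrArg d hz
      rw [degree_act hd hαm hy', degree_act hd hγ hy'] at this
      omega
    have hmul (α' : List E) : LPA.mono Q b α' (β ++ m) * LPA.mono Q b (β ++ m) (β ++ m) =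
        LPA.mono Q b α' (β ++ m) := by
      calc _ = LPA.path Q b α' * (LPA.copath Q b (β ++ m) * LPA.path Q b (β ++ m)) *
              LPA.copath Q b (β ++ m) := by simp only [LPA.mono, mul_assoc]
        _ = _ := by rw [LPA.copath_mul_path Q hδ, LPA.path_mul_vertex]; rfl
    refine ⟨⟨_, LPA.mono_mem_invSemigroup Q b (β ++ m) (β ++ m)⟩, Subtype.ext (hmul _),
      ⟨x, (B.mem_action_mono rfl).2 ⟨hδ, hδ, y', hy', h1', h1'⟩⟩, Subtype.ext ?_⟩
    change s.1 * _ = t.1 * _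
    rw [hsm, htm, hmul]
    calc _ = LPA.path Q a α * (LPA.copath Q a β * LPA.path Q b (β ++ m)) *
            LPA.copath Q b (β ++ m) := by simp only [LPA.mono, mul_assoc]
      _ = _ := by
        rw [LPA.copath_mul_path_append Q m hβ hstart, LPA.path_append Q a b α m hstart, hαγ]; rfl
  rcases le_total β.length δ.length with hlen | hlen
  · exact key s t hsm htm hα hβ hγ hδ hy hy' hyx hyx' hyz hyz' hlen
  · obtain ⟨f, hf, hx, h⟩ := key t s htm hsm hγ hδ hα hβ hy' hy hyx' hyx hyz' hyz hlen
    exact ⟨f, hf, hx, h.symm⟩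

end BranchingSystem

/-! ### Existence of faithful branching systems -/

/-- The edges emitted by a vertex act as injections of `ℕ` with disjoint ranges, covering `ℕ` exactly
if the vertex is regular. -/
theorem exists_branching [Countable E] (Q : OrientedGraph V E) (a : V) :
    ∃ σ : {e // Q.src e = a} × ℕ → ℕ, Function.Injective σ ∧
      (Q.IsRegular a → Function.Surjective σ) ∧ (¬ Q.IsRegular a → ∀ q, σ q ≠ 0) := by
  by_cases ha : Q.IsRegular a
  · have : Nonempty {e // Q.src e = a} := ha.2.to_subtype
    obtain ⟨σ⟩ := nonempty_equiv_of_countable (α := {e // Q.src e = a} × ℕ) (β := ℕ)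
    exact ⟨σ, σ.injective, fun _ => σ.surjective, fun h => absurd ha h⟩
  · obtain ⟨σ, hσ⟩ := exists_injective_nat ({e // Q.src e = a} × ℕ)
    -- The shift by one keeps `0` outside every edge range at a singular vertex.
    exact ⟨fun q => σ q + 1, fun q q' h => hσ (Nat.succ_injective h), fun h => absurd h ha,
      fun _ q => Nat.succ_ne_zero _⟩

/-- An edge changes the vertex, applies the injection of `ℕ` attached to its source, and raises the
integer coordinate, which is the degree. Points `(a, 0, 0)` witness faithfulness. -/
theorem exists_branchingSystem [Countable E] (Q : OrientedGraph V E) {N : Type w}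
    (i : N ≃ V × ℕ × ℤ) : ∃ B : BranchingSystem Q N, B.IsFaithful := by
  choose σ hinj hsurj hne using exists_branching Q
  -- Transport along an equality of source vertices, since the domain of `σ` depends on the vertex.
  have hσ {e : E} (b : V) (hb : Q.src e = b) (k : ℕ) :
      σ (Q.src e) (⟨e, rfl⟩, k) = σ b (⟨e, hb⟩, k) := by
    subst hb; rfl
  refine ⟨{
    vtx := fun x => (i x).1
    edge := fun e x => i.symm (Q.src e, σ (Q.src e) (⟨e, rfl⟩, (i x).2.1), (i x).2.2 + 1)
    vtx_edge := fun e x _ => by simp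
    edge_inj := ?_
    exists_edge := ?_ }, ?_, fun x => (i x).2.2, fun e x _ => by simp⟩
  · intro e f x y hx hy h
    have h := i.symm.injective h
    obtain ⟨h1, h2, h3⟩ : Q.src e = Q.src f ∧ σ (Q.src e) (⟨e, rfl⟩, (i x).2.1) =
      σ (Q.src f) (⟨f, rfl⟩, (i y).2.1) ∧ (i x).2.2 + 1 = (i y).2.2 + 1 := by simpa using h
    have h4 : σ (Q.src f) (⟨e, h1⟩, (i x).2.1) = σ (Q.src f) (⟨f, rfl⟩, (i y).2.1) :=
      (hσ _ h1 _).symm.trans h2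
    have h5 := hinj _ h4
    simp only [Prod.mk.injEq, Subtype.mk.injEq] at h5
    obtain ⟨rfl, h5⟩ := h5
    exact ⟨rfl, i.injective (Prod.ext (hx.trans hy.symm) (Prod.ext h5 (by simpa using h3)))⟩
  · intro z hz
    obtain ⟨⟨⟨e, he⟩, k⟩, hk⟩ := hsurj _ hz (i z).2.1
    refine ⟨e, i.symm (Q.rng e, k, (i z).2.2 - 1), by simp, ?_⟩
    rw [Equiv.symm_apply_eq]
    simp [hσ _ he, hk, he]
  · intro a
    refine ⟨i.symm (a, 0, 0), by simp, fun ha e x _ h => ?_⟩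
    have h := i.symm.injective h
    simp only [Prod.mk.injEq] at h
    obtain ⟨rfl, h, -⟩ := h
    exact hne _ ha _ h

/-! ## Germs -/

namespace PartialAction

variable {Q : OrientedGraph V E} {X : Type w} (S : PartialAction Q X)

/-- An idempotent partial injection is the identity on its domain. -/
theorem eq_of_idempotent {f : invSemigroup Q} (hf : f * f = f) {x y : X} (h : y ∈ S.toFun f x) :
    x = y := by
  have h' := h
  rw [← hf, S.map_mul', PEquiv.mem_trans] at h'
  obtain ⟨z, hz, hzy⟩ := h'
  obtain rfl : z = y := Option.mem_unique hz h
  exact (S.toFun f).inj h hzy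

variable {S}

/-- The image of the base point of a germ. -/
def PreGerm.val (g : S.PreGerm) : X := g.mem_dom.choose

theorem PreGerm.val_mem (g : S.PreGerm) : g.val ∈ S.toFun g.elt g.pt := g.mem_dom.choose_spec

theorem PreGerm.val_eq {g : S.PreGerm} {y : X} (h : y ∈ S.toFun g.elt g.pt) : g.val = y :=
  Option.mem_unique g.val_mem h

/-- The idempotent `f` fixes the base point, so multiplying by it on the right does not change the
value there. Hence the range of a germ is well defined. -/
theorem GermRel.val_eq {g k : S.PreGerm} (h : S.GermRel g k) : g.val = k.val := by
  obtain ⟨hpt, f, hf, ⟨y, hy⟩, hfg⟩ := h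
  obtain rfl := S.eq_of_idempotent hf hy
  refine PreGerm.val_eq ?_
  have key (t : invSemigroup Q) (z : X) : z ∈ S.toFun (t * f) g.pt ↔ z ∈ S.toFun t g.pt := by
    rw [S.map_mul', PEquiv.mem_trans]
    exact ⟨fun ⟨b, hb, hz⟩ => S.eq_of_idempotent hf hb ▸ hz, fun hz => ⟨_, hy, hz⟩⟩
  rw [← key, hfg, key, hpt]
  exact k.val_mem

variable (S)

/-- The range and the source of a germ. -/
def Germ.ends : S.Germ → X × X :=
  Quot.lift (fun g => (g.val, g.pt)) fun _ _ h => Prod.ext h.val_eq h.1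

theorem Germ.ends_germ (g : S.PreGerm) : Germ.ends S (S.germ g) = (g.val, g.pt) := rfl

theorem Germ.exists_ends {k : S.Germ} {s : invSemigroup Q} {y : X}
    (h : y ∈ S.toFun s (Germ.ends S k).1) :
    ∃ g l, g ∈ S.bisection s ∧ S.IsProduct g k l ∧ Germ.ends S l = (y, (Germ.ends S k).2) := by
  obtain ⟨b, rfl⟩ := Quot.exists_rep k
  have hb : y ∈ S.toFun (s * b.elt) b.pt := by
    rw [S.map_mul', PEquiv.mem_trans]
    exact ⟨b.val, b.val_mem, h⟩
  exact ⟨S.germ ⟨s, b.val, y, h⟩, S.germ ⟨s * b.elt, b.pt, y, hb⟩, ⟨_, rfl, rfl⟩,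
    ⟨_, _, _, rfl, rfl, rfl, b.val_mem, rfl, rfl⟩, Prod.ext (PreGerm.val_eq hb) rfl⟩

theorem Germ.ends_of_isProduct {g k l : S.Germ} (h : S.IsProduct g k l) :
    Germ.ends S g = ((Germ.ends S l).1, (Germ.ends S k).1) ∧
      (Germ.ends S k).2 = (Germ.ends S l).2 := by
  obtain ⟨a, b, c, rfl, rfl, rfl, hab, hc, hpt⟩ := h
  simp only [Germ.ends_germ]
  have hb : b.val = a.pt := PreGerm.val_eq hab
  refine ⟨Prod.ext (PreGerm.val_eq ?_).symm hb.symm, hpt.symm⟩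
  rw [hc, hpt, S.map_mul', PEquiv.mem_trans]
  exact ⟨a.pt, hab, a.val_mem⟩

theorem Germ.mem_of_mem_bisection {g : S.Germ} {s : invSemigroup Q} (h : g ∈ S.bisection s) :
    (Germ.ends S g).1 ∈ S.toFun s (Germ.ends S g).2 := by
  obtain ⟨a, rfl, rfl⟩ := h
  exact a.val_mem

theorem Germ.exists_ends_eq (hS : S.IsTight) (x : X) : ∃ g, Germ.ends S g = (x, x) := by
  have hx : x ∈ ⋃ a, S.vertexSet a := hS.iUnion_vertexSet ▸ Set.mem_univ x
  obtain ⟨a, y, hy⟩ := Set.mem_iUnion.1 hx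
  have hv : invSemigroup.of Q (Gen.vertex a) * invSemigroup.of Q (Gen.vertex a) =
    invSemigroup.of Q (Gen.vertex a) := Subtype.ext (LPA.vertex_mul_self Q a)
  obtain rfl := S.eq_of_idempotent hv hy
  exact ⟨S.germ ⟨_, x, x, hy⟩, Prod.ext (PreGerm.val_eq hy) rfl⟩

/-- Convolution with the characteristic function of `Θ_s`, if germs are determined by their
endpoints. -/
theorem convolution_indicator_bisection (hS : Function.Injective (Germ.ends S))
    (s : invSemigroup Q) (ξ : S.Germ → ℂ) {k l : S.Germ}
    (h1 : (Germ.ends S l).1 ∈ S.toFun s (Germ.ends S k).1)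
    (h2 : (Germ.ends S l).2 = (Germ.ends S k).2) :
    S.convolution ((S.bisection s).indicator 1) ξ l = ξ k := by
  obtain ⟨g, l', hg, hl', hends⟩ := Germ.exists_ends S h1
  obtain rfl : l' = l := hS (by rw [hends, ← h2])
  -- Only one factorization of `l'` has its first factor in `Θ_s`: injectivity of the partial
  -- injection of `s` determines the range of the second factor, and endpoints determine germs.
  rw [convolution, finsum_eq_single _ (g, k)]
  · simp [hl', hg]
  · rintro ⟨g', k'⟩ hne
    by_cases hp : S.IsProduct g' k' l'
    swap
    · simp [hp]
    by_cases hg' : g' ∈ S.bisection s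
    · refine absurd ?_ hne
      have hp' := Germ.ends_of_isProduct S hp
      have hp := Germ.ends_of_isProduct S hl'
      have hm := Germ.mem_of_mem_bisection S hg'
      rw [hp'.1] at hm
      have hk : (Germ.ends S k').1 = (Germ.ends S k).1 := (S.toFun s).inj hm h1
      refine Prod.ext (hS ?_) (hS ?_)
      · rw [hp.1, hp'.1, hk]
      · exact Prod.ext hk (hp'.2.trans hp.2.symm)
    · simp [hg']

theorem convolution_indicator_bisection_eq_zero (s : invSemigroup Q) (ξ : S.Germ → ℂ) {l : S.Germ}
    (h : ∀ k, (Germ.ends S l).1 ∈ S.toFun s (Germ.ends S k).1 →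
      (Germ.ends S l).2 ≠ (Germ.ends S k).2) :
    S.convolution ((S.bisection s).indicator 1) ξ l = 0 := by
  refine finsum_mem_eq_zero_of_forall_eq_zero ?_
  rintro ⟨g, k⟩ hp
  by_cases hg : g ∈ S.bisection s
  · have hp' := Germ.ends_of_isProduct S hp
    have hm := Germ.mem_of_mem_bisection S hg
    rw [hp'.1] at hm
    exact absurd hp'.2.symm (h k hm)
  · simp [hg]

end PartialAction

/-! ### The germ groupoid as a branching system -/

namespace BranchingSystem

variable {Q : OrientedGraph V E} {X : Type w} {B : BranchingSystem Q X}

/-- The groupoid of germs is principal: it is an equivalence relation on `X`. This reduces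
convolution to the first coordinate of pairs. -/
theorem IsFaithful.ends_injective (hB : B.IsFaithful) :
    Function.Injective (PartialAction.Germ.ends B.action) := by
  intro g k h
  obtain ⟨a, rfl⟩ := Quot.exists_rep g
  obtain ⟨b, rfl⟩ := Quot.exists_rep k
  have hv : a.val = b.val := congrArg Prod.fst h
  have hpt : a.pt = b.pt := congrArg Prod.snd h
  refine Quot.sound ⟨hpt, hB.exists_idempotent (z := a.val) a.val_mem ?_⟩
  rw [hv, hpt]
  exact b.val_mem

variable {N : Type*} {j : N → X × X}

open Classical in
/-- The restriction of `(x, y) ↦ (S_e x, y)` to an invariant set of pairs, parametrized by `j`. -/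
def pullback (B : BranchingSystem Q X) (j : N → X × X) (hj : Function.Injective j)
    (h : ∀ (t : invSemigroup Q) n y, y ∈ B.action.toFun t (j n).1 → ∃ k, j k = (y, (j n).2)) :
    BranchingSystem Q N :=
  have key (e : E) (n : N) (hn : B.vtx (j n).1 = Q.rng e) :
      ∃ k, j k = (B.edge e (j n).1, (j n).2) :=
    h (invSemigroup.of Q (.edge e)) n _ (by
      rw [action_of]; exact mem_edgeEquiv.2 ⟨hn, rfl⟩)
  have hedge (e : E) (n : N) (hn : B.vtx (j n).1 = Q.rng e) :
      j (if hn : _ then (key e n hn).choose else n) = (B.edge e (j n).1, (j n).2) := by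
    rw [dif_pos hn, (key e n hn).choose_spec]
  { vtx n := B.vtx (j n).1
    edge e n := if hn : B.vtx (j n).1 = Q.rng e then (key e n hn).choose else n
    vtx_edge e n hn := by
      rw [hedge e n hn]
      exact B.vtx_edge e _ hn
    edge_inj e f n m hn hm hnm := by
      have := congrArg j hnm
      rw [hedge e n hn, hedge f m hm] at this
      obtain ⟨h1, h2⟩ := Prod.mk.inj this
      obtain ⟨h3, h4⟩ := B.edge_inj e f _ _ hn hm h1
      exact ⟨h3, hj (Prod.ext h4 h2)⟩
    exists_edge m hm := by
      obtain ⟨e, x, hx, hxm⟩ := B.exists_edge _ hm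
      -- Invariance under ghost edges supplies the preimage, so regular vertices remain covered.
      obtain ⟨k, hk⟩ := h (invSemigroup.of Q (.ghost e)) m x (by
        rw [action_of]; exact mem_edgeEquiv_symm.2 ⟨hx, hxm⟩)
      have hk' : B.vtx (j k).1 = Q.rng e := by rw [hk, hx]
      refine ⟨e, k, hk', hj ?_⟩
      rw [hedge e k hk', hk, hxm] }

variable {hj : Function.Injective j}
  {h : ∀ (t : invSemigroup Q) n y, y ∈ B.action.toFun t (j n).1 → ∃ k, j k = (y, (j n).2)}

theorem vtx_pullback (n : N) : (B.pullback j hj h).vtx n = B.vtx (j n).1 := rfl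

theorem edge_pullback (e : E) (n : N) (hn : B.vtx (j n).1 = Q.rng e) :
    j ((B.pullback j hj h).edge e n) = (B.edge e (j n).1, (j n).2) := by
  classical
  change j (if hn : B.vtx (j n).1 = Q.rng e then _ else n) = _
  rw [dif_pos hn]
  exact Exists.choose_spec (_ : ∃ k, j k = _)

theorem mem_edgeEquiv_pullback {e : E} {n m : N} : m ∈ (B.pullback j hj h).edgeEquiv e n ↔
    (j m).1 ∈ B.edgeEquiv e (j n).1 ∧ (j m).2 = (j n).2 := by
  rw [mem_edgeEquiv, mem_edgeEquiv, vtx_pullback]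
  constructor
  · rintro ⟨hn, rfl⟩
    rw [edge_pullback e n hn]
    exact ⟨⟨hn, rfl⟩, rfl⟩
  · rintro ⟨⟨hn, h1⟩, h2⟩
    refine ⟨hn, hj ?_⟩
    rw [edge_pullback e n hn, h1, ← h2]

/-- Checked on generators and extended to products; invariance guarantees that the intermediate pair
is again in the image of `j`. -/
theorem mem_action_pullback (s : invSemigroup Q) (n m : N) :
    m ∈ (B.pullback j hj h).action.toFun s n ↔
      (j m).1 ∈ B.action.toFun s (j n).1 ∧ (j m).2 = (j n).2 := by
  obtain ⟨s, hs⟩ := s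
  induction hs using Subsemigroup.closure_induction generalizing n m with
  | mem x hx =>
    obtain rfl | ⟨g, rfl⟩ := hx
    · change m ∈ (action _).toFun (invSemigroup.zero Q) n ↔
        _ ∈ B.action.toFun (invSemigroup.zero Q) _ ∧ _
      rw [PartialAction.map_zero', PartialAction.map_zero']
      exact ⟨fun hm => absurd hm (notMem_bot _ _), fun hm => absurd hm.1 (notMem_bot _ _)⟩
    · change m ∈ (action _).toFun (invSemigroup.of Q g) n ↔
        _ ∈ B.action.toFun (invSemigroup.of Q g) _ ∧ _
      rw [action_of, action_of]
      cases g with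
      | vertex a =>
        simp only [genEquiv, mem_vertexEquiv, vtx_pullback]
        constructor
        · rintro ⟨hn, rfl⟩
          exact ⟨⟨hn, rfl⟩, rfl⟩
        · rintro ⟨⟨hn, h1⟩, h2⟩
          exact ⟨hn, hj (Prod.ext h1 h2.symm)⟩
      | edge e => exact mem_edgeEquiv_pullback
      | ghost e =>
        simp only [genEquiv, PEquiv.mem_iff_mem, mem_edgeEquiv_pullback]
        exact and_congr_right fun _ => eq_comm
  | mul s t hs ht ihs iht =>
    change m ∈ (action _).toFun ((⟨s, hs⟩ : invSemigroup Q) * ⟨t, ht⟩) n ↔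
        _ ∈ B.action.toFun ((⟨s, hs⟩ : invSemigroup Q) * ⟨t, ht⟩) _ ∧ _
    rw [PartialAction.map_mul', PartialAction.map_mul', PEquiv.mem_trans, PEquiv.mem_trans]
    constructor
    · rintro ⟨k, hk, hm⟩
      rw [iht] at hk
      rw [ihs] at hm
      exact ⟨⟨_, hk.1, hm.1⟩, hm.2.trans hk.2⟩
    · rintro ⟨⟨y, hy, hym⟩, h2⟩
      obtain ⟨k, hk⟩ := h ⟨t, ht⟩ n y hy
      refine ⟨k, (iht n k).2 ?_, (ihs k m).2 ?_⟩
      · rw [hk]; exact ⟨hy, rfl⟩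
      · rw [hk]; exact ⟨hym, h2⟩

/-- Diagonal pairs inherit the uncovered points of `B`, and the degree is read from the first
coordinate. -/
theorem IsFaithful.pullback (hB : B.IsFaithful) (hdiag : ∀ x, ∃ n, j n = (x, x)) :
    (B.pullback j hj h).IsFaithful where
  exists_vtx a := by
    obtain ⟨y, hy, hys⟩ := hB.exists_vtx a
    obtain ⟨n, hn⟩ := hdiag y
    refine ⟨n, by rw [vtx_pullback, hn, hy], fun ha e m hm hmn => ?_⟩
    have := edge_pullback (hj := hj) (h := h) e m hm
    rw [hmn, hn] at this
    exact hys ha e _ hm (congrArg Prod.fst this).symm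
  exists_degree := by
    obtain ⟨d, hd⟩ := hB.exists_degree
    refine ⟨fun n => d (j n).1, fun e n hn => ?_⟩
    exact (congrArg (fun x => d x.1) (edge_pullback (hj := hj) (h := h) e n hn)).trans (hd e _ hn)

/-- The branching system on a set in bijection with the groupoid of germs of a faithful branching
system, given by left multiplication. -/
theorem IsFaithful.exists_germ (hB : B.IsFaithful) (φ : B.action.Germ ≃ N) :
    ∃ C : BranchingSystem Q N, C.IsFaithful ∧
      ∀ (s : invSemigroup Q) (ξ : N → ℂ) (l : B.action.Germ),
        C.rep s ξ (φ l) = B.action.convolution ((B.action.bisection s).indicator 1)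
          (fun k => ξ (φ k)) l := by
  have hj : Function.Injective fun n => PartialAction.Germ.ends B.action (φ.symm n) :=
    hB.ends_injective.comp φ.symm.injective
  -- The image of the groupoid in `X × X` is invariant because a germ can be multiplied on the left
  -- by `[t, x]`, with `x` its range.
  have hinv (t : invSemigroup Q) (n : N) (y : X)
      (hy : y ∈ B.action.toFun t (PartialAction.Germ.ends B.action (φ.symm n)).1) :
      ∃ k, PartialAction.Germ.ends B.action (φ.symm k) =
        (y, (PartialAction.Germ.ends B.action (φ.symm n)).2) := by
    obtain ⟨-, l, -, -, hl⟩ := PartialAction.Germ.exists_ends B.action hy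
    exact ⟨φ l, by simpa using hl⟩
  refine ⟨B.pullback _ hj hinv, hB.pullback ?_, fun s ξ l => ?_⟩
  · intro x
    obtain ⟨g, hg⟩ := PartialAction.Germ.exists_ends_eq B.action B.isTight_action x
    exact ⟨φ g, by simpa using hg⟩
  · rw [rep_eq_lin]
    by_cases hl : ∃ n, φ l ∈ (B.pullback _ hj hinv).action.toFun s n
    · obtain ⟨n, hn⟩ := hl
      rw [lin_apply_of_mem hn]
      rw [mem_action_pullback, Equiv.symm_apply_apply] at hn
      rw [PartialAction.convolution_indicator_bisection _ hB.ends_injective s _ hn.1 hn.2,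
        Equiv.apply_symm_apply]
    · push Not at hl
      rw [lin_apply_of_notMem hl, PartialAction.convolution_indicator_bisection_eq_zero]
      intro k hk hk'
      refine hl (φ k) ?_
      rw [mem_action_pullback, Equiv.symm_apply_apply, Equiv.symm_apply_apply]
      exact ⟨hk, hk'⟩

end BranchingSystem

/-! ## Spatial isometries induced by measure preserving maps -/

section MeasurePreserving

variable {X : Type w} [MeasurableSpace X] {μ ν : Measure X} {g g' : X → X}

theorem preimage_preimage_ae_eq (h : ∀ᵐ x ∂μ, g (g' x) = x) (F : Set X) :
    g' ⁻¹' (g ⁻¹' F) =ᵐ[μ] F :=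
  Filter.eventuallyEq_set.2 (h.mono fun x hx => by rw [Set.mem_preimage, Set.mem_preimage, hx])

/-- The set transformation `F ↦ g⁻¹ F` of an almost everywhere invertible measure preserving
map. -/
def SetTransformation.ofMeasurePreserving (hg : MeasurePreserving g ν μ)
    (hg' : MeasurePreserving g' μ ν) (h : ∀ᵐ y ∂ν, g' (g y) = y) (h' : ∀ᵐ x ∂μ, g (g' x) = x) :
    SetTransformation μ ν where
  toFun F := g ⁻¹' F
  measurableSet' _ hF := hg.measurable hF
  congr' _ _ _ _ hFG := hg.quasiMeasurePreserving.preimage_ae_eq hFG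
  compl' _ _ := Filter.EventuallyEq.rfl
  iUnion' F _ := by rw [Set.preimage_iUnion]; exact .rfl
  injective' F G _ _ hFG :=
    ((preimage_preimage_ae_eq h' F).symm.trans
      (hg'.quasiMeasurePreserving.preimage_ae_eq hFG)).trans (preimage_preimage_ae_eq h' G)
  surjective' G hG := ⟨g' ⁻¹' G, hg'.measurable hG, preimage_preimage_ae_eq h G⟩

variable (p : ℝ≥0∞)

theorem comp_comp_ae_eq (hg : MeasurePreserving g ν μ) (hg' : MeasurePreserving g' μ ν)
    (h : ∀ᵐ y ∂ν, g' (g y) = y) (ξ : Lp ℂ p ν) :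
    Lp.compMeasurePreserving g hg (Lp.compMeasurePreserving g' hg' ξ) = ξ := by
  refine Lp.ext ?_
  filter_upwards [Lp.coeFn_compMeasurePreserving (Lp.compMeasurePreserving g' hg' ξ) hg,
    hg.quasiMeasurePreserving.ae_eq_comp (Lp.coeFn_compMeasurePreserving ξ hg'), h]
    with y h1 h2 h3
  rw [h1, h2]
  simp only [Function.comp_apply, h3]

variable [Fact (1 ≤ p)]

/-- The isometric isomorphism of `L^p`-spaces given by an almost everywhere invertible measure
preserving map. -/
def compEquiv (hg : MeasurePreserving g ν μ) (hg' : MeasurePreserving g' μ ν)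
    (h : ∀ᵐ y ∂ν, g' (g y) = y) (h' : ∀ᵐ x ∂μ, g (g' x) = x) : Lp ℂ p μ ≃ₗᵢ[ℂ] Lp ℂ p ν where
  toLinearEquiv := LinearEquiv.ofLinearMap (Lp.compMeasurePreservingₗ ℂ g hg)
    (Lp.compMeasurePreservingₗ ℂ g' hg') (LinearMap.ext (comp_comp_ae_eq p hg hg' h))
    (LinearMap.ext (comp_comp_ae_eq p hg' hg h'))
  norm_map' ξ := Lp.norm_compMeasurePreserving ξ hg

variable {p}

theorem compEquiv_apply (hg : MeasurePreserving g ν μ) (hg' : MeasurePreserving g' μ ν)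
    (h : ∀ᵐ y ∂ν, g' (g y) = y) (h' : ∀ᵐ x ∂μ, g (g' x) = x) (ξ : Lp ℂ p μ) :
    compEquiv p hg hg' h h' ξ = Lp.compMeasurePreserving g hg ξ := rfl

theorem isSpatialIso_compEquiv [SigmaFinite ν] (hg : MeasurePreserving g ν μ)
    (hg' : MeasurePreserving g' μ ν) (h : ∀ᵐ y ∂ν, g' (g y) = y) (h' : ∀ᵐ x ∂μ, g (g' x) = x) :
    IsSpatialIso (compEquiv p hg hg' h h') := by
  -- Measure preservation makes the image measure `ν` itself, with density `1`, and the phase is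
  -- `1`.
  refine ⟨.ofMeasurePreserving hg hg' h h', ν, fun _ => 1, ⟨.rfl, fun F hF => ?_⟩,
    measurable_const, by simp, fun ξ => ⟨ξ ∘ g, ⟨?_, fun U _ => .rfl⟩, ?_⟩⟩
  · exact hg.measure_preimage hF.nullMeasurableSet
  · exact (Lp.stronglyMeasurable ξ).measurable.comp hg.measurable
  · filter_upwards [Lp.coeFn_compMeasurePreserving ξ hg, ν.rnDeriv_self] with x h1 h2
    rw [compEquiv_apply, h1, h2]
    simp

end MeasurePreserving

/-! ## Partial injections of countable sets as spatial partial isometries -/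

section Count

variable {N : Type w}

/-- The domain of a partial injection. -/
def domain (f : N ≃. N) : Set N := {x | ∃ y, y ∈ f x}

/-- The extension of a partial injection by the identity. -/
def extend (f : N ≃. N) (x : N) : N := (f x).getD x

theorem extend_mem {f : N ≃. N} {x : N} (hx : x ∈ domain f) : extend f x ∈ f x := by
  obtain ⟨y, hy⟩ := hx
  rw [extend, (hy : f x = some y)]
  rfl

theorem extend_symm_extend {f : N ≃. N} {x : N} (hx : x ∈ domain f) :
    extend f.symm (extend f x) = x := by
  have h : x ∈ f.symm (extend f x) := f.mem_iff_mem.2 (extend_mem hx)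
  rw [extend, (h : f.symm _ = some x)]
  rfl

theorem extend_mem_domain_symm {f : N ≃. N} {x : N} (hx : x ∈ domain f) :
    extend f x ∈ domain f.symm := ⟨x, f.mem_iff_mem.2 (extend_mem hx)⟩

/-- This is the shape `ι_B U π_A` of a spatial partial isometry, with `U` a composition operator. -/
theorem lin_eq_indicator (f : N ≃. N) (ξ : N → ℂ) :
    lin f ξ = (domain f.symm).indicator (ξ ∘ extend f.symm) := by
  classical
  ext y
  rw [Set.indicator_apply]
  split_ifs with hy
  · exact lin_apply_of_mem (f.mem_iff_mem.1 (extend_mem hy)) ξ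
  · exact lin_apply_of_notMem (fun x hx => hy ⟨x, f.mem_iff_mem.2 hx⟩) ξ

variable [MeasurableSpace N]

theorem eq_of_ae_count {ξ η : N → ℂ} (h : ξ =ᵐ[Measure.count] η) : ξ = η :=
  funext (Measure.ae_count_iff.1 h)

variable {p : ℝ≥0∞}

variable (N p) in
/-- Elements of `ℓ^p` as functions. -/
def toFunₗ : Lp ℂ p (Measure.count : Measure N) →ₗ[ℂ] (N → ℂ) where
  toFun ξ := ξ
  map_add' ξ η := eq_of_ae_count (Lp.coeFn_add ξ η)
  map_smul' z ξ := eq_of_ae_count (Lp.coeFn_smul z ξ)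

theorem toFunₗ_injective : Function.Injective (toFunₗ N p) :=
  fun _ _ h => Lp.ext (.of_forall fun x => congrFun h x)

theorem toFunₗ_toLp {ξ : N → ℂ} (hξ : MemLp ξ p Measure.count) : toFunₗ N p (hξ.toLp ξ) = ξ :=
  eq_of_ae_count hξ.coeFn_toLp

variable [DiscreteMeasurableSpace N]

/-- A bijection preserves cardinality. Taking `g` with an equation lets the same statement serve `f`
and its inverse. -/
theorem measurePreserving_extend {f g : N ≃. N} (hfg : f.symm = g) : MeasurePreserving (extend f)
    (Measure.count.restrict (domain f)) (Measure.count.restrict (domain g)) := by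
  subst hfg
  refine ⟨.of_discrete, Measure.ext fun F _ => ?_⟩
  rw [Measure.map_apply .of_discrete .of_discrete, Measure.restrict_apply .of_discrete,
    Measure.restrict_apply .of_discrete, Measure.count_apply .of_discrete,
    Measure.count_apply .of_discrete]
  have himg : extend f '' (extend f ⁻¹' F ∩ domain f) = F ∩ domain f.symm := by
    ext y
    constructor
    · rintro ⟨x, ⟨hxF, hx⟩, rfl⟩
      exact ⟨hxF, extend_mem_domain_symm hx⟩
    · rintro ⟨hyF, hy⟩
      have h : extend f (extend f.symm y) = y := extend_symm_extend (f := f.symm) hy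
      exact ⟨extend f.symm y, ⟨by rwa [Set.mem_preimage, h], extend_mem_domain_symm hy⟩, h⟩
  rw [← himg, Set.InjOn.encard_image]
  intro x hx y hy h
  rw [← extend_symm_extend hx.2, h, extend_symm_extend hy.2]

theorem memLp_comp_extend {f : N ≃. N} {ξ : N → ℂ} (hξ : MemLp ξ p Measure.count) :
    MemLp (ξ ∘ extend f.symm) p (Measure.count.restrict (domain f.symm)) :=
  (hξ.restrict (domain f)).comp_measurePreserving (measurePreserving_extend f.symm_symm)

theorem memLp_lin (f : N ≃. N) {ξ : N → ℂ} (hξ : MemLp ξ p Measure.count) :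
    MemLp (lin f ξ) p Measure.count := by
  rw [lin_eq_indicator, memLp_indicator_iff_restrict .of_discrete]
  exact memLp_comp_extend hξ

theorem eLpNorm_lin_le (f : N ≃. N) {ξ : N → ℂ} (hξ : MemLp ξ p Measure.count) :
    eLpNorm (lin f ξ) p Measure.count ≤ eLpNorm ξ p Measure.count := by
  rw [lin_eq_indicator, eLpNorm_indicator_eq_eLpNorm_restrict .of_discrete,
    eLpNorm_comp_measurePreserving (hξ.restrict (domain f)).1
      (measurePreserving_extend f.symm_symm)]
  exact eLpNorm_restrict_le ξ p _ _

variable [Fact (1 ≤ p)]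

/-- The operator on `ℓ^p` induced by a partial injection. -/
def linLp (f : N ≃. N) :
    Lp ℂ p (Measure.count : Measure N) →L[ℂ] Lp ℂ p (Measure.count : Measure N) :=
  LinearMap.mkContinuous
    { toFun := fun ξ => (memLp_lin f (Lp.memLp ξ)).toLp _
      map_add' := fun ξ η => toFunₗ_injective <| by
        rw [map_add, toFunₗ_toLp, toFunₗ_toLp, toFunₗ_toLp]
        exact (congrArg (lin f) (map_add (toFunₗ N p) ξ η)).trans (map_add (lin f) _ _)
      map_smul' := fun z ξ => toFunₗ_injective <| by
        rw [RingHom.id_apply, map_smul, toFunₗ_toLp, toFunₗ_toLp]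
        exact (congrArg (lin f) (map_smul (toFunₗ N p) z ξ)).trans (map_smul (lin f) _ _) }
    1 fun ξ => by
      rw [one_mul]
      change ‖(memLp_lin f (Lp.memLp ξ)).toLp _‖ ≤ _
      rw [Lp.norm_toLp, Lp.norm_def]
      exact ENNReal.toReal_mono (Lp.eLpNorm_ne_top ξ) (eLpNorm_lin_le f (Lp.memLp ξ))

theorem toFunₗ_linLp (f : N ≃. N) (ξ : Lp ℂ p (Measure.count : Measure N)) :
    toFunₗ N p (linLp f ξ) = lin f (toFunₗ N p ξ) :=
  toFunₗ_toLp (memLp_lin f (Lp.memLp ξ))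

/-- Stated for any `U` given by composition, so that it covers both the isometry and its inverse. -/
theorem factors_linLp {f : N ≃. N}
    {U : Lp ℂ p (Measure.count.restrict (domain f)) ≃ₗᵢ[ℂ]
      Lp ℂ p (Measure.count.restrict (domain f.symm))}
    (hU : ∀ ξ, U ξ = Lp.compMeasurePreserving _ (measurePreserving_extend f.symm_symm) ξ) :
    Factors (linLp f) (domain f) (domain f.symm) U := by
  intro ξ
  have h1 := Lp.coeFn_compMeasurePreserving
    (LpToLpRestrictCLM N ℂ ℂ Measure.count p (domain f) ξ)
    (measurePreserving_extend f.symm_symm)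
  have h2 := (measurePreserving_extend f.symm_symm).quasiMeasurePreserving.ae_eq_comp
    (LpToLpRestrictCLM_coeFn (μ := Measure.count) ℂ (domain f) ξ)
  have h3 := (ae_restrict_iff' (.of_discrete : MeasurableSet (domain f.symm))).1 (h1.trans h2)
  filter_upwards [h3] with y hy
  rw [hU, show linLp f ξ y = lin f ξ y from congrFun (toFunₗ_linLp f ξ) y, lin_eq_indicator]
  by_cases hyd : y ∈ domain f.symm
  · rw [Set.indicator_of_mem hyd, Set.indicator_of_mem hyd, hy hyd]
  · rw [Set.indicator_of_notMem hyd, Set.indicator_of_notMem hyd]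

theorem isSpatialWithReverse_linLp [Countable N] (f : N ≃. N) :
    IsSpatialWithReverse (p := p) (μ := Measure.count) (linLp f) (linLp f.symm) := by
  have h (f : N ≃. N) : ∀ᵐ x ∂Measure.count.restrict (domain f),
      extend f.symm (extend f x) = x :=
    (ae_restrict_iff' .of_discrete).2 (.of_forall fun x hx => extend_symm_extend hx)
  exact ⟨domain f, domain f.symm,
    compEquiv p (measurePreserving_extend f.symm_symm) (measurePreserving_extend rfl)
      (h f.symm) (h f), .of_discrete, .of_discrete, isSpatialIso_compEquiv _ _ _ _,
    factors_linLp fun ξ => rfl, factors_linLp (f := f.symm) fun ξ => rfl⟩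

/-! ### The `ℓ^p` representation of a branching system -/

namespace BranchingSystem

variable {Q : OrientedGraph V E} (B : BranchingSystem Q N)

/-- The inclusion of `ℓ^p` in all functions intertwines the two actions, so the Leavitt relations
transfer to `ℓ^p`. -/
theorem toFunₗ_lift (x : FreeAlgebra ℂ (Gen V E)) (ξ : Lp ℂ p (Measure.count : Measure N)) :
    toFunₗ N p (FreeAlgebra.lift ℂ (fun g => linLp (p := p) (B.genEquiv g)) x ξ) =
      FreeAlgebra.lift ℂ (fun g => lin (B.genEquiv g)) x (toFunₗ N p ξ) := by
  induction x using FreeAlgebra.induction generalizing ξ with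
  | grade0 z =>
    rw [AlgHom.commutes, AlgHom.commutes, Algebra.algebraMap_eq_smul_one,
      Algebra.algebraMap_eq_smul_one]
    exact map_smul (toFunₗ N p) z ξ
  | grade1 g =>
    rw [FreeAlgebra.lift_ι_apply, FreeAlgebra.lift_ι_apply, toFunₗ_linLp]
  | mul x y hx hy =>
    rw [map_mul, map_mul, mul_apply_eq_comp, Module.End.mul_apply, hx, hy]
  | add x y hx hy =>
    rw [map_add, map_add, add_apply, LinearMap.add_apply, map_add, hx, hy]

variable (p) in
/-- The representation of `L_Q` on `ℓ^p` of a branching system. -/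
def repLp : LPA Q →ₙₐ[ℂ]
    (Lp ℂ p (Measure.count : Measure N) →L[ℂ] Lp ℂ p (Measure.count : Measure N)) :=
  LPA.lift Q (fun g => linLp (B.genEquiv g)) fun x y h =>
    ContinuousLinearMap.ext fun ξ => toFunₗ_injective <| by
      rw [toFunₗ_lift, toFunₗ_lift, B.lift_lin_eq_of_rel x y h]

theorem repLp_of (g : Gen V E) : B.repLp p (LPA.of Q g) = linLp (B.genEquiv g) :=
  LPA.lift_of Q _ _ g

theorem toFunₗ_repLp (a : LPA Q) (ξ : Lp ℂ p (Measure.count : Measure N)) :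
    toFunₗ N p (B.repLp p a ξ) = B.rep a (toFunₗ N p ξ) := by
  induction a using LPA.induction generalizing ξ with
  | of g => rw [repLp_of, rep_of, toFunₗ_linLp]
  | zero => simp
  | add a b ha hb =>
    rw [map_add, map_add, add_apply, LinearMap.add_apply, map_add, ha, hb]
  | mul a b ha hb =>
    rw [map_mul, map_mul, mul_apply_eq_comp, Module.End.mul_apply, ha, hb]
  | smul z a ha =>
    rw [map_smul, map_smul, smul_apply, LinearMap.smul_apply, map_smul, ha]

theorem isSpatial_repLp [Countable N] : IsSpatial Q (B.repLp p) where
  vertex a := ⟨by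
      rw [IsIdempotentElem, ← map_mul, LPA.vertex_mul_self],
    ⟨_, by
      rw [LPA.vertex, repLp_of]
      exact isSpatialWithReverse_linLp _⟩⟩
  edge e := by
    rw [LPA.edge, LPA.ghost, repLp_of, repLp_of]
    exact isSpatialWithReverse_linLp _

variable {B}

theorem IsFaithful.repLp_injective (hB : B.IsFaithful) : Function.Injective (B.repLp p) := by
  classical
  intro a b hab
  suffices h : a + (-1 : ℂ) • b = 0 by
    calc a = a + ((-1 : ℂ) • b + (1 : ℂ) • b) := by
          rw [← add_smul, neg_add_cancel, zero_smul, add_zero]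
      _ = b := by rw [← add_assoc, h, zero_add, one_smul]
  refine hB.eq_zero fun x => ?_
  have hx : MemLp (Pi.single x 1 : N → ℂ) p Measure.count := by
    have := memLp_indicator_const (μ := Measure.count) p
      (.of_discrete : MeasurableSet ({x} : Set N)) (1 : ℂ) (.inr (by simp))
    convert this using 1
    ext y
    by_cases hy : y = x
    · rw [hy]; simp
    · simp [hy]
  have h (c : LPA Q) := B.toFunₗ_repLp c (hx.toLp _)
  simp only [toFunₗ_toLp] at h
  rw [map_add, map_smul, LinearMap.add_apply, LinearMap.smul_apply, ← h, ← h, hab, neg_one_smul,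
    add_neg_cancel]

variable (B) (p) in
/-- The functions supported over finitely many vertices. -/
def finiteVertexSubmodule : Submodule ℂ (Lp ℂ p (Measure.count : Measure N)) where
  carrier := {ξ | ∃ F : Finset V, ∀ x, toFunₗ N p ξ x ≠ 0 → B.vtx x ∈ F}
  zero_mem' := ⟨∅, fun x hx => absurd (by simp) hx⟩
  add_mem' := by
    classical
    rintro ξ η ⟨F, hF⟩ ⟨G, hG⟩
    refine ⟨F ∪ G, fun x hx => ?_⟩
    rw [Finset.mem_union]
    by_contra! h
    have h1 : toFunₗ N p ξ x = 0 := by_contra fun h' => h.1 (hF x h')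
    have h2 : toFunₗ N p η x = 0 := by_contra fun h' => h.2 (hG x h')
    exact hx (by rw [map_add, Pi.add_apply, h1, h2, add_zero])
  smul_mem' := by
    rintro z ξ ⟨F, hF⟩
    refine ⟨F, fun x hx => hF x fun h => hx ?_⟩
    rw [map_smul, Pi.smul_apply, h, smul_zero]

/-- Finite sums of vertices act as local units. -/
theorem repLp_sum_vertex {ξ : Lp ℂ p (Measure.count : Measure N)} {F : Finset V}
    (hF : ∀ x, toFunₗ N p ξ x ≠ 0 → B.vtx x ∈ F) :
    B.repLp p (∑ a ∈ F, LPA.vertex Q a) ξ = ξ := by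
  refine toFunₗ_injective (funext fun x => ?_)
  rw [toFunₗ_repLp, map_sum, LinearMap.sum_apply, Finset.sum_apply]
  have hv (a : V) : B.rep (LPA.vertex Q a) = lin (B.vertexEquiv a) := B.rep_of _
  simp only [hv]
  rw [Finset.sum_eq_single (B.vtx x)]
  · exact lin_apply_of_mem (mem_vertexEquiv.2 ⟨rfl, rfl⟩) _
  · intro a _ ha
    refine lin_apply_of_notMem (fun y hy => ha ?_) _
    obtain ⟨hya, rfl⟩ := mem_vertexEquiv.1 hy
    exact hya.symm
  · intro hx
    rw [lin_apply_of_mem (mem_vertexEquiv.2 ⟨rfl, rfl⟩)]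
    exact by_contra fun h => hx (hF x h)

variable (B) in
theorem isNondegenerate_repLp (hp : p ≠ ∞) : IsNondegenerate Q (B.repLp p) := by
  have hdense (ξ) : ξ ∈ (B.finiteVertexSubmodule p).topologicalClosure := by
    induction ξ using Lp.induction hp with
    | @indicatorConst c s hs hμs =>
      refine Submodule.le_topologicalClosure _ ?_
      -- For `p < ∞` simple functions of finite-measure support suffice, and finite counting measure
      -- means finitely many points, hence finitely many vertices.
      have hfin : s.Finite := Measure.count_apply_lt_top.1 hμs
      classical
      refine ⟨hfin.toFinset.image B.vtx, fun x hx => ?_⟩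
      refine Finset.mem_image_of_mem _ (hfin.mem_toFinset.2 (by_contra fun hxs => hx ?_))
      have h : toFunₗ N p (Lp.simpleFunc.indicatorConst p hs hμs.ne c) = s.indicator fun _ => c := by
        rw [Lp.simpleFunc.coe_indicatorConst]
        exact eq_of_ae_count indicatorConstLp_coeFn
      rw [h, Set.indicator_of_notMem hxs]
    | add _ _ _ h1 h2 => exact add_mem h1 h2
    | isClosed => exact Submodule.isClosed_topologicalClosure _
  have hdense' : Dense (B.finiteVertexSubmodule p : Set (Lp ℂ p (Measure.count : Measure N))) :=
    hdense
  refine hdense'.mono ?_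
  rintro ξ ⟨F, hF⟩
  exact ⟨_, ξ, repLp_sum_vertex hF⟩

end BranchingSystem

end Count

/-! ## The spatial norm -/

section Norm

variable {p : ℝ≥0∞} [Fact (1 ≤ p)]

theorem IsSpatialWithReverse.norm_le {X : Type w} [MeasurableSpace X] {μ : Measure X}
    {s t : Lp ℂ p μ →L[ℂ] Lp ℂ p μ} (h : IsSpatialWithReverse s t) : ‖s‖ ≤ 1 := by
  obtain ⟨A, B, U, -, hB, -, hs, -⟩ := h
  refine s.opNorm_le_bound zero_le_one fun ξ => ?_
  calc ‖s ξ‖ = ‖U (LpToLpRestrictCLM X ℂ ℂ μ p A ξ)‖ := by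
        rw [Lp.norm_def, Lp.norm_def, eLpNorm_congr_ae (hs ξ),
          eLpNorm_indicator_eq_eLpNorm_restrict hB]
    _ = ‖LpToLpRestrictCLM X ℂ ℂ μ p A ξ‖ := U.norm_map _
    _ ≤ 1 * ‖ξ‖ := by
        rw [one_mul]
        exact norm_Lp_toLp_restrict_le A ξ

theorem IsSpatialWithReverse.norm_reverse_le {X : Type w} [MeasurableSpace X] {μ : Measure X}
    {s t : Lp ℂ p μ →L[ℂ] Lp ℂ p μ} (h : IsSpatialWithReverse s t) : ‖t‖ ≤ 1 := by
  obtain ⟨A, B, U, hA, hB, -, -, ht⟩ := h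
  refine t.opNorm_le_bound zero_le_one fun ξ => ?_
  calc ‖t ξ‖ = ‖U.symm (LpToLpRestrictCLM X ℂ ℂ μ p B ξ)‖ := by
        rw [Lp.norm_def, Lp.norm_def, eLpNorm_congr_ae (ht ξ),
          eLpNorm_indicator_eq_eLpNorm_restrict hA]
    _ = ‖LpToLpRestrictCLM X ℂ ℂ μ p B ξ‖ := U.symm.norm_map _
    _ ≤ 1 * ‖ξ‖ := by
        rw [one_mul]
        exact norm_Lp_toLp_restrict_le B ξ

variable (p) (Q : OrientedGraph V E)

/-- Generators have norm at most `1` in every spatial representation, and bounds pass to sums,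
products and multiples without depending on the representation. -/
theorem exists_norm_le (a : LPA Q) :
    ∃ C : ℝ, ∀ N ∈ spatialSeminorms.{u, v, w} Q p, N a ≤ C := by
  suffices h : ∃ C : ℝ, ∀ (X : Type w) (_ : MeasurableSpace X) (μ : Measure X)
      (ρ : LPA Q →ₙₐ[ℂ] (Lp ℂ p μ →L[ℂ] Lp ℂ p μ)), IsSpatial Q ρ → ‖ρ a‖ ≤ C by
    obtain ⟨C, hC⟩ := h
    refine ⟨C, ?_⟩
    rintro N ⟨X, _, μ, _, ρ, hρ, hN⟩
    rw [hN]
    exact hC X _ μ ρ hρ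
  induction a using LPA.induction with
  | of x =>
    refine ⟨1, fun X _ μ ρ hρ => ?_⟩
    cases x with
    | vertex a => exact (hρ.vertex a).2.choose_spec.norm_le
    | edge e => exact (hρ.edge e).norm_le
    | ghost e => exact (hρ.edge e).norm_reverse_le
  | zero => exact ⟨0, fun X _ μ ρ _ => by rw [map_zero, norm_zero]⟩
  | add a b ha hb =>
    obtain ⟨C, hC⟩ := ha
    obtain ⟨D, hD⟩ := hb
    refine ⟨C + D, fun X _ μ ρ hρ => ?_⟩
    rw [map_add]
    exact (norm_add_le _ _).trans (add_le_add (hC X _ μ ρ hρ) (hD X _ μ ρ hρ))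
  | mul a b ha hb =>
    obtain ⟨C, hC⟩ := ha
    obtain ⟨D, hD⟩ := hb
    refine ⟨C * D, fun X _ μ ρ hρ => ?_⟩
    rw [map_mul]
    exact (norm_mul_le _ _).trans (mul_le_mul (hC X _ μ ρ hρ) (hD X _ μ ρ hρ) (norm_nonneg _)
      ((norm_nonneg _).trans (hC X _ μ ρ hρ)))
  | smul z a ha =>
    obtain ⟨C, hC⟩ := ha
    refine ⟨‖z‖ * C, fun X _ μ ρ hρ => ?_⟩
    rw [map_smul, norm_smul]
    exact mul_le_mul_of_nonneg_left (hC X _ μ ρ hρ) (norm_nonneg z)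

/-- There is a faithful spatial seminorm. -/
theorem exists_faithful_spatialSeminorm [Countable V] [Countable E] :
    ∃ N ∈ spatialSeminorms.{u, v, w} Q p, ∀ a, N a = 0 → a = 0 := by
  -- The space must live in `Type w`: the countable set `V` is shrunk to `Type` and then lifted.
  obtain ⟨B, hB⟩ := exists_branchingSystem Q (N := ULift.{w} (Shrink.{0} V × ℕ × ℤ))
    (Equiv.ulift.trans ((equivShrink.{0} V).symm.prodCongr (Equiv.refl _)))
  let _ : MeasurableSpace (ULift.{w} (Shrink.{0} V × ℕ × ℤ)) := ⊤
  have _ : DiscreteMeasurableSpace (ULift.{w} (Shrink.{0} V × ℕ × ℤ)) := ⟨fun _ => trivial⟩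
  have _ : Countable (Shrink.{0} V) := (equivShrink.{0} V).symm.countable_iff.2 ‹_›
  have _ : Countable (ULift.{w} (Shrink.{0} V × ℕ × ℤ)) := Equiv.ulift.countable_iff.2 inferInstance
  refine ⟨fun a => ‖B.repLp p a‖, ⟨_, _, Measure.count, inferInstance, B.repLp p,
    B.isSpatial_repLp, fun _ => rfl⟩, fun a ha => hB.repLp_injective (p := p) ?_⟩
  rw [norm_eq_zero.1 ha, map_zero]

/-- The real `sSup` takes a default value on empty or unbounded sets; the faithful seminorm and the
uniform bound exclude both cases. -/
theorem isLUB_spatialNorm [Countable V] [Countable E] (a : LPA Q) :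
    IsLUB {c : ℝ | ∃ N ∈ spatialSeminorms.{u, v, w} Q p, c = N a}
      (spatialNorm.{u, v, w} Q p a) := by
  obtain ⟨N, hN, -⟩ := exists_faithful_spatialSeminorm.{u, v, w} p Q
  obtain ⟨C, hC⟩ := exists_norm_le.{u, v, w} p Q a
  refine isLUB_csSup ⟨_, N, hN, rfl⟩ ⟨C, ?_⟩
  rintro _ ⟨M, hM, rfl⟩
  exact hC M hM

variable {p Q}

theorem le_spatialNorm [Countable V] [Countable E] {N : LPA Q → ℝ}
    (hN : N ∈ spatialSeminorms.{u, v, w} Q p) (a : LPA Q) : N a ≤ spatialNorm.{u, v, w} Q p a :=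
  (isLUB_spatialNorm p Q a).1 ⟨N, hN, rfl⟩

theorem spatialNorm_le [Countable V] [Countable E] {a : LPA Q} {C : ℝ}
    (h : ∀ N ∈ spatialSeminorms.{u, v, w} Q p, N a ≤ C) : spatialNorm.{u, v, w} Q p a ≤ C := by
  refine (isLUB_spatialNorm p Q a).2 ?_
  rintro _ ⟨N, hN, rfl⟩
  exact h N hN

variable (p Q)

theorem spatialNorm_add_le [Countable V] [Countable E] (a b : LPA Q) :
    spatialNorm.{u, v, w} Q p (a + b) ≤
      spatialNorm.{u, v, w} Q p a + spatialNorm.{u, v, w} Q p b := by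
  refine spatialNorm_le fun N hN => ?_
  refine le_trans ?_ (add_le_add (le_spatialNorm hN a) (le_spatialNorm hN b))
  obtain ⟨X, _, μ, _, ρ, hρ, h⟩ := hN
  rw [h, h, h, map_add]
  exact norm_add_le _ _

theorem spatialNorm_smul_le [Countable V] [Countable E] (z : ℂ) (a : LPA Q) :
    spatialNorm.{u, v, w} Q p (z • a) ≤ ‖z‖ * spatialNorm.{u, v, w} Q p a := by
  refine spatialNorm_le fun N hN => ?_
  refine le_trans ?_ (mul_le_mul_of_nonneg_left (le_spatialNorm hN a) (norm_nonneg z))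
  obtain ⟨X, _, μ, _, ρ, hρ, h⟩ := hN
  rw [h, h, map_smul]
  exact (norm_smul z (ρ a)).le

theorem spatialNorm_zero [Countable V] [Countable E] : spatialNorm.{u, v, w} Q p 0 = 0 := by
  refine le_antisymm (by simpa using spatialNorm_smul_le.{u, v, w} p Q 0 0) ?_
  obtain ⟨N, hN, -⟩ := exists_faithful_spatialSeminorm.{u, v, w} p Q
  refine le_trans ?_ (le_spatialNorm hN 0)
  obtain ⟨X, _, μ, _, ρ, hρ, h⟩ := hN
  rw [h]
  exact norm_nonneg _

theorem spatialNorm_smul [Countable V] [Countable E] (z : ℂ) (a : LPA Q) :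
    spatialNorm.{u, v, w} Q p (z • a) = ‖z‖ * spatialNorm.{u, v, w} Q p a := by
  refine le_antisymm (spatialNorm_smul_le p Q z a) ?_
  by_cases hz : z = 0
  · rw [hz, norm_zero, zero_mul, zero_smul, spatialNorm_zero]
  · have h := spatialNorm_smul_le.{u, v, w} p Q z⁻¹ (z • a)
    rwa [inv_smul_smul₀ hz, norm_inv, le_inv_mul_iff₀ (norm_pos_iff.2 hz)] at h

theorem spatialNorm_eq_zero [Countable V] [Countable E] (a : LPA Q) :
    spatialNorm.{u, v, w} Q p a = 0 ↔ a = 0 := by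
  refine ⟨fun ha => ?_, fun ha => by rw [ha, spatialNorm_zero]⟩
  obtain ⟨N, hN, hinj⟩ := exists_faithful_spatialSeminorm.{u, v, w} p Q
  refine hinj a (le_antisymm (ha ▸ le_spatialNorm hN a) ?_)
  obtain ⟨X, _, μ, _, ρ, hρ, h⟩ := hN
  rw [h]
  exact norm_nonneg _

end Norm

/-! ## The regular representation of the groupoid of germs -/

theorem LPA.countable_monos [Countable V] [Countable E] (Q : OrientedGraph V E) :
    (LPA.monos Q).Countable := by
  have h : LPA.monos Q ⊆ insert 0 (Set.range fun t : V × List E × List E =>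
      LPA.mono Q t.1 t.2.1 t.2.2) := by
    rintro x (rfl | ⟨a, α, β, rfl⟩)
    · exact Set.mem_insert _ _
    · exact Set.mem_insert_of_mem _ ⟨(a, α, β), rfl⟩
  exact ((Set.countable_range _).insert 0).mono h

instance countable_invSemigroup [Countable V] [Countable E] (Q : OrientedGraph V E) :
    Countable (invSemigroup Q) :=
  ((LPA.countable_monos Q).mono fun _ => LPA.mem_monos_of_mem_invSemigroup Q).to_subtype

theorem PartialAction.countable_germ [Countable V] [Countable E] {Q : OrientedGraph V E}
    {X : Type w} [Countable X] (S : PartialAction Q X) : Countable S.Germ := by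
  have h : Function.Injective fun g : S.PreGerm => (g.elt, g.pt) := by
    rintro ⟨s, x, h⟩ ⟨t, y, h'⟩ hst
    obtain ⟨rfl, rfl⟩ := Prod.mk.inj hst
    rfl
  have : Countable S.PreGerm := h.countable
  exact Quot.mk_surjective.countable

/-- Tightness provides a unit germ over each point, and units over distinct points differ. -/
theorem PartialAction.infinite_germ {Q : OrientedGraph V E} {X : Type w} [Infinite X]
    {S : PartialAction Q X} (hS : S.IsTight) : Infinite S.Germ := by
  choose g hg using PartialAction.Germ.exists_ends_eq S hS
  exact Infinite.of_injective g fun x y h =>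
    congrArg Prod.fst ((hg x).symm.trans ((congrArg _ h).trans (hg y)))

end Leavitt

end

/-! ### The main theorem -/

theorem mainTheorem6 {V : Type u} {E : Type v} [Countable V] [Countable E]
    (Q : Leavitt.OrientedGraph V E) (p : ℝ≥0∞) [Fact (1 ≤ p)] (hp : p ≠ ∞) :
    (Nonempty V →
      ∃ ρ : Leavitt.LPA Q →ₙₐ[ℂ] (Leavitt.EllP p →L[ℂ] Leavitt.EllP p),
        Function.Injective ρ ∧ Leavitt.IsNondegenerate Q ρ ∧ Leavitt.IsSpatial Q ρ ∧
        ∃ (X : Type) (_ : Countable X) (S : Leavitt.PartialAction Q X) (φ : S.Germ ≃ ℕ),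
          S.IsTight ∧
          ∀ (s : Leavitt.invSemigroup Q) (ξ : Leavitt.EllP p) (l : S.Germ),
            ρ s.1 ξ (φ l) = S.convolution ((S.bisection s).indicator 1) (fun k => ξ (φ k)) l) ∧
    (∀ a : Leavitt.LPA Q,
      IsLUB {c : ℝ | ∃ N ∈ Leavitt.spatialSeminorms.{u, v, w} Q p, c = N a}
        (Leavitt.spatialNorm.{u, v, w} Q p a)) ∧
    (∀ a b : Leavitt.LPA Q, Leavitt.spatialNorm.{u, v, w} Q p (a + b) ≤
      Leavitt.spatialNorm.{u, v, w} Q p a + Leavitt.spatialNorm.{u, v, w} Q p b) ∧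
    (∀ (z : ℂ) (a : Leavitt.LPA Q), Leavitt.spatialNorm.{u, v, w} Q p (z • a) =
      ‖z‖ * Leavitt.spatialNorm.{u, v, w} Q p a) ∧
    (∀ a : Leavitt.LPA Q, Leavitt.spatialNorm.{u, v, w} Q p a = 0 ↔ a = 0) := by
  refine ⟨fun hV => ?_, Leavitt.isLUB_spatialNorm p Q, Leavitt.spatialNorm_add_le p Q,
    Leavitt.spatialNorm_smul p Q, Leavitt.spatialNorm_eq_zero p Q⟩
  obtain ⟨B, hB⟩ := Leavitt.exists_branchingSystem Q (N := Shrink.{0} V × ℕ × ℤ)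
    ((equivShrink.{0} V).symm.prodCongr (Equiv.refl _))
  have : Countable (Shrink.{0} V) := (equivShrink.{0} V).symm.countable_iff.2 ‹_›
  have : Nonempty (Shrink.{0} V) := (equivShrink.{0} V).symm.nonempty_congr.2 hV
  have := B.action.countable_germ
  have := Leavitt.PartialAction.infinite_germ B.isTight_action
  obtain ⟨φ⟩ := nonempty_equiv_of_countable (α := B.action.Germ) (β := ℕ)
  -- The representation is that of `C`, by left multiplication on germs; `B` supplies the tight
  -- action.
  obtain ⟨C, hC, hconv⟩ := hB.exists_germ φ
  refine ⟨C.repLp p, hC.repLp_injective, C.isNondegenerate_repLp hp, C.isSpatial_repLp, _,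
    inferInstance, B.action, φ, B.isTight_action, fun s ξ l => ?_⟩
  exact (congrFun (C.toFunₗ_repLp s.1 ξ) (φ l)).trans (hconv s _ l)
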